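/- Let $d\ge 0$ and consider observations $(X_i,Y_i,Z_i)_{i\ge1}$ with $X_i,Y_i\in\mathbb R$, $Z_i\in\mathbb R^d$. For $\delta\in\mathbb R$, $\beta\in\mathbb R^d$, $\sigma>0$ the linear model with parameters $(\delta,\beta,\sigma)$ says $$Y_i=\delta\sigma X_i+\beta^\top Z_i+\sigma\varepsilon_i ,\qquad \varepsilon_1,\varepsilon_2,\dots \text{ i.i.d. } N(0,1),$$ with $(\varepsilon_i)_i$ independent of the covariates $(X_i,Z_i)_i$, whose law is arbitrary. Write $Y^n=(Y_1,\dots,Y_n)^\top$, $X^n=(X_1,\dots,X_n)^\top$, let $\mathbf Z_n$ be the $n\times d$ matrix with rows $Z_1,\dots,Z_n$, and let $k=k_n=n-\operatorname{rank}\mathbf Z_n$. Let $\mathbf A_n$ be a $k\times n$ matrix, depending measurably on $\mathbf Z_n$, whose rows form an orthonormal basis of the orthogonal complement of the column space of $\mathbf Z_n$. Put $$U_n=\frac{\mathbf A_nY^n}{\|\mathbf A_nY^n\|},\qquad b_n=\mathbf A_nX^n,\qquad \mathbf P_n=\mathbf I_k-\frac{b_nb_n^\top}{b_n^\top b_n},\qquad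 T_n=t_n(U_n)=\frac{b_n^\top U_n/\|b_n\|}{\frac1{\sqrt{k-1}}\|\mathbf P_nU_n\|},$$ with the convention that division by zero gives zero (so $U_n=0$ if $\mathbf A_nY^n=0$, and $t_n\equiv0$ if $b_n=0$). For $\nu\ge1$ let $\mathrm T(\nu,\lambda)$ be the noncentral Student $t$ distribution with $\nu$ degrees of freedom and noncentrality $\lambda$, i.e. the law of $G/\sqrt{V/\nu}$ with $G\sim N(\lambda,1)$ and $V\sim\chi^2_\nu$ independent, and let $$f_{\mathrm T(\nu,\lambda)}(t)=\frac{\nu^{\nu/2}\,e^{-\nu\lambda^2/(2(t^2+\nu))}}{\sqrt\pi\,\Gamma(\nu/2)\,2^{(\nu-1)/2}\,(t^2+\nu)^{(\nu+1)/2}}\int_0^\infty y^\nu e^{-\frac12\left(y-\lambda t/\sqrt{t^2+\nu}\right)^2}dy .$$ Fix $\delta_0<\delta_+$. 1. $f_{\mathrm T(\nu,\lambda)}$ is the Lebesgue density of $\mathrm T(\nu,\lambda)$, and for $\lambda_0\le\lambda_+$ the ratio $f_{\mathrm T(\nu,\lambda_+)}/f_{\mathrm T(\nu,\lambda_0)}$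 is nondecreasing (monotone likelihood ratio property). 2. Given fixed values of the covariates, let the law of $U_n$ be the law of $\mathbf A_nY^n/\|\mathbf A_nY^n\|$ when $Y_1,\dots,Y_n$ are independent with $Y_i\sim N(\delta\sigma X_i+\beta^\top Z_i,\sigma^2)$. Under the linear model this is a regular version of the conditional law of $U_n$ given $(X^n,\mathbf Z_n)$. It depends on $(\delta,\beta,\sigma)$ only through $\delta$. If $k\ge2$ then, with $\nu=k-1$, - (sufficiency) it has density $q_n(u)\,f_{\mathrm T(\nu,\delta\|b_n\|)}(t_n(u))$ with respect to surface measure on the unit sphere $S^{k-1}$, where $$q_n(u)=\tfrac12\pi^{-\nu/2}\sqrt\nu\,\Gamma(\nu/2)\Big(1+\tfrac{t_n(u)^2}\nu\Big)^{(\nu+1)/2}$$ does not depend on $\delta$; - if $b_n\neq0$, then $T_n\sim\mathrm T(k-1,\delta\|b_n\|)$. 3. Define $$p_n(u)=\frac{f_{\mathrm T(k-1,\delta_+\|b_n\|)}(t_n(u))}{f_{\mathrm T(k-1,\delta_0\|b_n\|)}(t_n(u))}\quad\text{if }k\ge2,$$ and, if $k\le1$ (when $U_n$ is discrete: it takes the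 values $\pm1$ if $k=1$ and a single value if $k=0$), let $p_n(u)$ be the ratio of the probability mass of $u$ under $\delta_+$ to that under $\delta_0$ (with $0/0=0$). Given the covariates, $p_n$ is the density of the law of $U_n$ under $\delta_+$ with respect to its law under $\delta_0$. 4. With $M_n=(U_n,X^n,\mathbf Z_n)$, the process $(p_n(U_n))_{n\ge0}$ is a test supermartingale for $\mathcal H_{\delta\le\delta_0}$ in the filtration $(\sigma(M_1,\dots,M_n))_{n\ge0}$: it is nonnegative, $p_0=1$, and it is a supermartingale under every law of the linear model with parameters $(\delta,\beta,\sigma)$ with $\delta\le\delta_0$, $\beta\in\mathbb R^d$, $\sigma>0$. For $\delta=\delta_0$ it is a martingale. -/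

import Mathlib

open MeasureTheory ProbabilityTheory
open scoped ENNReal Matrix

noncomputable section

/-! ### The noncentral Student `t` distribution -/

/-- The noncentral `t` distribution with `ν` degrees of freedom and noncentrality `lam`: the law of
`G / √(V / ν)`, where `G ∼ N(lam, 1)` and `V`, the sum of the squares of `ν` independent standard
Gaussians, is an independent `χ²` variable with `ν` degrees of freedom. -/
def noncentralT (ν : ℕ) (lam : ℝ) : Measure ℝ :=
  ((gaussianReal lam 1).prod (Measure.pi fun _ : Fin ν => gaussianReal 0 1)).map
    (fun p => p.1 / √((∑ i, p.2 i ^ 2) / ν))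

/-- The Lebesgue density of the noncentral `t` distribution. -/
def noncentralTPDF (ν : ℕ) (lam t : ℝ) : ℝ :=
  (ν : ℝ) ^ ((ν : ℝ) / 2) * Real.exp (-(ν * lam ^ 2) / (2 * (t ^ 2 + ν))) /
      (√Real.pi * Real.Gamma ((ν : ℝ) / 2) * 2 ^ (((ν : ℝ) - 1) / 2) *
        (t ^ 2 + ν) ^ (((ν : ℝ) + 1) / 2)) *
    ∫ y in Set.Ioi (0 : ℝ), y ^ ν * Real.exp (-(y - lam * t / √(t ^ 2 + ν)) ^ 2 / 2)

/-! ### Residuals -/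

/-- A choice, for every `n` and every `n × d` matrix `z` of rank `r`, of an `(n - r) × n` matrix
`A z` whose rows form an orthonormal basis of the orthogonal complement of the column space of `z`
(they are orthonormal, orthogonal to the columns of `z`, and as many as the dimension of the
complement). The choice is Borel measurable in `z`, so that quantities computed from it are random
variables when `z` is random. -/
structure ResidualBasis (d : ℕ) where
  /-- The chosen matrix. -/
  mat : ∀ (n : ℕ) (z : Fin n → Fin d → ℝ), Matrix (Fin (n - (Matrix.of z).rank)) (Fin n) ℝ
  orthonormal : ∀ n z, mat n z * (mat n z)ᵀ = 1
  mul_design : ∀ n z, mat n z * Matrix.of z = 0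
  measurable : ∀ n, Measurable fun z : Fin n → Fin d → ℝ =>
    (⟨n - (Matrix.of z).rank, fun i j => mat n z i j⟩ : Σ k : ℕ, Fin k → Fin n → ℝ)

/-- The residual dimension `k = n - rank z`. -/
abbrev resDim {n d : ℕ} (z : Fin n → Fin d → ℝ) : ℕ := n - (Matrix.of z).rank

/-- The compressed residual `A y`. -/
def compress {k n : ℕ} (A : Matrix (Fin k) (Fin n) ℝ) (y : Fin n → ℝ) :
    EuclideanSpace ℝ (Fin k) := WithLp.toLp 2 (A *ᵥ y)

/-- The normalized residual `A y / ‖A y‖`. -/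
def normalizedResidual {k n : ℕ} (A : Matrix (Fin k) (Fin n) ℝ) (y : Fin n → ℝ) :
    EuclideanSpace ℝ (Fin k) := ‖compress A y‖⁻¹ • compress A y

/-- The orthogonal projection `P u = u - b (bᵀ u) / (bᵀ b)` on the orthogonal complement of `b`. -/
def projOrth {k : ℕ} (b u : EuclideanSpace ℝ (Fin k)) : EuclideanSpace ℝ (Fin k) :=
  u - (inner ℝ b u / inner ℝ b b) • b

/-- The statistic `t(u) = (bᵀ u / ‖b‖) / (‖P u‖ / √(k - 1))`. -/
def tStat {k : ℕ} (b u : EuclideanSpace ℝ (Fin k)) : ℝ :=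
  (inner ℝ b u / ‖b‖) / (1 / √((k : ℝ) - 1) * ‖projOrth b u‖)

/-! ### The model given the covariates -/

/-- The law of `Yⁿ` for fixed covariates `x, z`: independent coordinates
`Yᵢ ∼ N(δ σ xᵢ + β · zᵢ, σ²)`. -/
def responseLaw {n d : ℕ} (δ : ℝ) (β : Fin d → ℝ) (σ : ℝ) (x : Fin n → ℝ)
    (z : Fin n → Fin d → ℝ) : Measure (Fin n → ℝ) :=
  Measure.pi fun i => gaussianReal (δ * σ * x i + β ⬝ᵥ z i) (σ ^ 2).toNNReal

/-- The law of the normalized residual `Uₙ` for fixed covariates `x, z`. -/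
def residualLaw {d n : ℕ} (A : ResidualBasis d) (δ : ℝ) (β : Fin d → ℝ) (σ : ℝ) (x : Fin n → ℝ)
    (z : Fin n → Fin d → ℝ) : Measure (EuclideanSpace ℝ (Fin (resDim z))) :=
  (responseLaw δ β σ x z).map (normalizedResidual (A.mat n z))

/-- Surface measure on the unit sphere of `ℝᵏ`, as a measure on `ℝᵏ`. -/
def sphereMeasure (k : ℕ) : Measure (EuclideanSpace ℝ (Fin k)) :=
  (volume : Measure (EuclideanSpace ℝ (Fin k))).toSphere.map Subtype.val

/-- The parameter-free factor of the density of `Uₙ`, with `ν = k - 1`, as a function of the value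
`t` of the statistic. -/
def qFactor (ν : ℕ) (t : ℝ) : ℝ :=
  1 / 2 * Real.pi ^ (-(ν : ℝ) / 2) * √ν * Real.Gamma ((ν : ℝ) / 2) *
    (1 + t ^ 2 / ν) ^ (((ν : ℝ) + 1) / 2)

/-- The likelihood ratio of `Uₙ` at `u`, given the covariates `x, z`. If `k ≥ 2` it is the ratio of
noncentral `t` densities at `tₙ(u)`. If `k ≤ 1` the variable `Uₙ` is discrete (it is a sign for
`k = 1` and takes a single value for `k = 0`) and the likelihood ratio is the ratio of its
probability mass functions. -/
def likelihoodRatio {d n : ℕ} (A : ResidualBasis d) (δ₀ δp : ℝ) (x : Fin n → ℝ)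
    (z : Fin n → Fin d → ℝ) (u : EuclideanSpace ℝ (Fin (resDim z))) : ℝ :=
  if 2 ≤ resDim z then
    noncentralTPDF (resDim z - 1) (δp * ‖compress (A.mat n z) x‖)
        (tStat (compress (A.mat n z) x) u) /
      noncentralTPDF (resDim z - 1) (δ₀ * ‖compress (A.mat n z) x‖)
        (tStat (compress (A.mat n z) x) u)
  else (residualLaw A δp 0 1 x z).real {u} / (residualLaw A δ₀ 0 1 x z).real {u}

/-! ### The sequential model

The sequences are indexed from `0`, so that the first `n` observations are those with index
`0, …, n - 1`. -/

section Sequential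

variable {Ω : Type*} [MeasurableSpace Ω] {d : ℕ}

/-- Under `P` the observations satisfy `Yᵢ = δ σ Xᵢ + β · Zᵢ + σ εᵢ` with `εᵢ` i.i.d. `N(0, 1)` and
independent of the covariates. The law of the covariates is arbitrary. -/
structure IsLinearModel (P : Measure Ω) (X Y : ℕ → Ω → ℝ) (Z : ℕ → Ω → Fin d → ℝ)
    (δ : ℝ) (β : Fin d → ℝ) (σ : ℝ) : Prop where
  exists_noise : ∃ ε : ℕ → Ω → ℝ,
    (∀ i, Measurable (ε i)) ∧ (∀ i, P.map (ε i) = gaussianReal 0 1) ∧ iIndepFun ε P ∧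
    IndepFun (fun ω i => ε i ω) (fun ω i => (X i ω, Z i ω)) P ∧
    ∀ i ω, Y i ω = δ * σ * X i ω + β ⬝ᵥ Z i ω + σ * ε i ω

/-- The first `n` terms of a sequence of random variables. -/
def firstN {α : Type*} (X : ℕ → Ω → α) (n : ℕ) (ω : Ω) : Fin n → α := fun i => X i ω

/-- The normalized residual `Uₙ`, a point of `ℝᵏ` with `k = n - rank Zₙ`. -/
def residualU (A : ResidualBasis d) (Y : ℕ → Ω → ℝ) (Z : ℕ → Ω → Fin d → ℝ) (n : ℕ) (ω : Ω) :
    EuclideanSpace ℝ (Fin (resDim (firstN Z n ω))) :=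
  normalizedResidual (A.mat n (firstN Z n ω)) (firstN Y n ω)

/-- `Uₙ` as a random variable in the disjoint union of the spaces `ℝᵏ`. -/
def residualSigma (A : ResidualBasis d) (Y : ℕ → Ω → ℝ) (Z : ℕ → Ω → Fin d → ℝ) (n : ℕ) (ω : Ω) :
    Σ k : ℕ, EuclideanSpace ℝ (Fin k) :=
  ⟨resDim (firstN Z n ω), residualU A Y Z n ω⟩

/-- The covariates `(Xⁿ, Zₙ)`. -/
def covariates (X : ℕ → Ω → ℝ) (Z : ℕ → Ω → Fin d → ℝ) (n : ℕ) (ω : Ω) :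
    (Fin n → ℝ) × (Fin n → Fin d → ℝ) := (firstN X n ω, firstN Z n ω)

/-- The coarsened observation `Mₙ = (Uₙ, Xⁿ, Zₙ)`. -/
def obsM (A : ResidualBasis d) (X Y : ℕ → Ω → ℝ) (Z : ℕ → Ω → Fin d → ℝ) (n : ℕ) (ω : Ω) :
    (Σ k : ℕ, EuclideanSpace ℝ (Fin k)) × ((Fin n → ℝ) × (Fin n → Fin d → ℝ)) :=
  (residualSigma A Y Z n ω, covariates X Z n ω)

/-- The likelihood ratio process `n ↦ p(Uₙ ∣ Xⁿ, Zₙ)`. -/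
def likelihoodRatioProcess (A : ResidualBasis d) (δ₀ δp : ℝ) (X Y : ℕ → Ω → ℝ)
    (Z : ℕ → Ω → Fin d → ℝ) (n : ℕ) (ω : Ω) : ℝ :=
  likelihoodRatio A δ₀ δp (firstN X n ω) (firstN Z n ω) (residualU A Y Z n ω)

theorem measurableEmbedding_sigma_mk {ι : Type*} {α : ι → Type*} [∀ i, MeasurableSpace (α i)]
    (k : ι) : MeasurableEmbedding (Sigma.mk k : α k → Σ i, α i) where
  injective := sigma_mk_injective
  measurable := fun _ hs => MeasurableSpace.measurableSet_iInf.1 hs k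
  measurableSet_image' := by
    intro s hs
    refine MeasurableSpace.measurableSet_iInf.2 fun j => ?_
    change MeasurableSet (Sigma.mk j ⁻¹' (Sigma.mk k '' s))
    by_cases h : k = j
    · subst h
      rwa [Set.preimage_image_eq _ sigma_mk_injective]
    · rw [Set.preimage_image_sigmaMk_of_ne (Ne.symm h)]
      exact MeasurableSet.empty

theorem measurable_residualSigma (A : ResidualBasis d) {Y : ℕ → Ω → ℝ} {Z : ℕ → Ω → Fin d → ℝ}
    (hY : ∀ i, Measurable (Y i)) (hZ : ∀ i, Measurable (Z i)) (n : ℕ) :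
    Measurable (residualSigma A Y Z n) := by
  let F : (Σ k : ℕ, Fin k → Fin n → ℝ) × (Fin n → ℝ) → Σ k : ℕ, EuclideanSpace ℝ (Fin k) :=
    fun p => ⟨p.1.1, normalizedResidual (Matrix.of p.1.2) p.2⟩
  have hk : ∀ k : ℕ, Measurable fun p : (Fin k → Fin n → ℝ) × (Fin n → ℝ) =>
      normalizedResidual (Matrix.of p.1) p.2 := by
    intro k
    have h : Measurable fun p : (Fin k → Fin n → ℝ) × (Fin n → ℝ) =>
        compress (Matrix.of p.1) p.2 := by
      unfold compress
      refine (WithLp.measurable_toLp 2 _).comp (measurable_pi_iff.2 fun i => ?_)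
      simp only [Matrix.mulVec, dotProduct, Matrix.of_apply]
      fun_prop
    exact h.norm.inv.smul h
  have hF : Measurable F := by
    intro s hs
    have : F ⁻¹' s = ⋃ k : ℕ, Prod.map (Sigma.mk k) id ''
        ((fun p : (Fin k → Fin n → ℝ) × (Fin n → ℝ) =>
          normalizedResidual (Matrix.of p.1) p.2) ⁻¹' {u | (⟨k, u⟩ : Σ k : ℕ, EuclideanSpace ℝ (Fin k)) ∈ s}) := by
      ext ⟨⟨k, a⟩, y⟩
      simp only [Set.mem_iUnion, Set.mem_image, Set.mem_preimage]
      constructor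
      · intro h
        exact ⟨k, (a, y), h, rfl⟩
      · rintro ⟨j, ⟨a', y'⟩, h, he⟩
        rw [← he]
        exact h
    rw [this]
    refine MeasurableSet.iUnion fun k => ?_
    exact ((measurableEmbedding_sigma_mk k).prodMap MeasurableEmbedding.id).measurableSet_image.2
      (hk k ((measurableEmbedding_sigma_mk k).measurable hs))
  have hz : Measurable (firstN Z n) := measurable_pi_iff.2 fun i => hZ i
  have hy : Measurable (firstN Y n) := measurable_pi_iff.2 fun i => hY i
  exact hF.comp (((A.measurable n).comp hz).prodMk hy)

theorem measurable_obsM (A : ResidualBasis d) {X Y : ℕ → Ω → ℝ} {Z : ℕ → Ω → Fin d → ℝ}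
    (hX : ∀ i, Measurable (X i)) (hY : ∀ i, Measurable (Y i)) (hZ : ∀ i, Measurable (Z i))
    (n : ℕ) : Measurable (obsM A X Y Z n) :=
  have hx : Measurable (firstN X n) := measurable_pi_iff.2 fun i => hX i
  have hz : Measurable (firstN Z n) := measurable_pi_iff.2 fun i => hZ i
  (measurable_residualSigma A hY hZ n).prodMk (hx.prodMk hz)

/-- The filtration `σ(M₁, …, Mₙ)` (the variable `M₀` is constant). -/
def obsFiltration (A : ResidualBasis d) {X Y : ℕ → Ω → ℝ} {Z : ℕ → Ω → Fin d → ℝ}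
    (hX : ∀ i, Measurable (X i)) (hY : ∀ i, Measurable (Y i)) (hZ : ∀ i, Measurable (Z i)) :
    Filtration ℕ (inferInstance : MeasurableSpace Ω) where
  seq n := ⨆ m ≤ n, MeasurableSpace.comap (obsM A X Y Z m) inferInstance
  mono' _ _ h := biSup_mono fun _ hm => hm.trans h
  le' _ := iSup₂_le fun m _ => (measurable_obsM A hX hY hZ m).comap_le

end Sequential

end

/-!
The hypotheses of the linear model enter only through the direction of a Gaussian vector. Applying
the residual matrix removes `β`, normalizing removes `σ`, and since the rows of the matrix are
orthonormal the residual direction `U` is the direction of a Gaussian vector with identity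
covariance and mean `δ b`, where `b = A x` (`residualLaw_eq_map`). In polar coordinates its density
relative to surface measure is, up to a factor not depending on the direction `u`, the tilted moment
`∫₀^∞ y ^ ν e ^ (δ ⟨b, u⟩ y - y² / 2) dy` with `ν = k - 1` (`map_normalize_stdGaussian`). The
noncentral `t` density contains the same integral, because `⟨b, u⟩ / ‖b‖` equals `t / √(t² + ν)` for
the value `t` of the statistic; this gives the factorization (`residualLaw_eq_withDensity_tStat`).
For the law of the statistic, a reflection takes `b` to the first axis (`map_tStat_stdGaussian`).

The monotone likelihood ratio property says that the quotient of the tilted moments at `b s` and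
`a s` is nondecreasing in `s` when `a ≤ b`. For `0 < s ≤ t`, rescaling turns the tilt at `t` into
the tilt at `s` with a flatter Gaussian weight, and the claim is Chebyshev's integral inequality for
the increasing functions `e ^ ((b - a) s y)` and `e ^ (c y²)`, `c ≥ 0`
(`monotone_tiltedMoment_ratio`).

The residual direction of the first `m ≤ n` observations is a function of the one of all `n`
(`restrictResidual_normalizedResidual`), so for fixed covariates the likelihood ratio of `δp` to
`δ₀` is a martingale under `δ₀` (`setLIntegral_likelihoodRatio_eq`). Under `δ < δ₀` the likelihood
ratio of `δp` to `δ₀` is nondecreasing and that of `δ` to `δ₀` is nonincreasing in the same variable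
`⟨b, u⟩`. Conditionally on the past they are negatively correlated under `δ₀`, and this is the
supermartingale inequality (`setLIntegral_comp_le_of_monotone_of_antitone`). Conditioning on all the
covariates, which are independent of the noise, reduces random covariates to fixed ones
(`IsLinearModel.lintegral_obsM`).
-/

noncomputable section

/-! ### Tilted moments of the half-line Gaussian weight -/

/-- The integral `∫₀^∞ y ^ ν e ^ (a y - y² / 2) dy`. As a function of `a` it carries the whole
dependence of the densities below on the effect size. -/
def tiltedMoment (ν : ℕ) (a : ℝ) : ℝ :=
  ∫ y in Set.Ioi (0 : ℝ), y ^ ν * Real.exp (a * y - y ^ 2 / 2)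

theorem integrableOn_pow_mul_exp (ν : ℕ) (a : ℝ) {c : ℝ} (hc : 0 < c) :
    IntegrableOn (fun y : ℝ => y ^ ν * Real.exp (a * y - c * (y ^ 2 / 2))) (Set.Ioi 0) := by
  have h1 : IntegrableOn (fun y : ℝ => Real.exp (a ^ 2 / c) *
      (y ^ (ν : ℝ) * Real.exp (-(c / 4) * y ^ 2))) (Set.Ioi 0) :=
    (integrableOn_rpow_mul_exp_neg_mul_sq (by positivity)
      (by have := Nat.cast_nonneg (α := ℝ) ν; linarith)).const_mul _
  refine h1.mono' (Measurable.aestronglyMeasurable (by fun_prop)) ?_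
  filter_upwards [ae_restrict_mem measurableSet_Ioi] with y hy
  have hy0 : (0 : ℝ) ≤ y ^ ν := pow_nonneg (le_of_lt hy) _
  rw [Real.norm_of_nonneg (by positivity), Real.rpow_natCast, mul_left_comm, ← Real.exp_add]
  gcongr
  -- completing the square: `a y ≤ a² / c + c y² / 4`
  have h : a ^ 2 / c + -(c / 4) * y ^ 2 - (a * y - c * (y ^ 2 / 2)) = (a - c * y / 2) ^ 2 / c := by
    field_simp
    ring
  have h' : 0 ≤ (a - c * y / 2) ^ 2 / c := by positivity
  linarith

theorem integrableOn_tilted (ν : ℕ) (a : ℝ) :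
    IntegrableOn (fun y : ℝ => y ^ ν * Real.exp (a * y - y ^ 2 / 2)) (Set.Ioi 0) := by
  simpa using integrableOn_pow_mul_exp ν a one_pos

theorem ofReal_setIntegral_Ioi {f : ℝ → ℝ} (hf : IntegrableOn f (Set.Ioi 0))
    (h0 : ∀ y, 0 < y → 0 ≤ f y) :
    ENNReal.ofReal (∫ y in Set.Ioi (0 : ℝ), f y) =
      ∫⁻ y in Set.Ioi (0 : ℝ), ENNReal.ofReal (f y) :=
  ofReal_integral_eq_lintegral_ofReal hf
    ((ae_restrict_mem measurableSet_Ioi).mono fun y hy => h0 y hy)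

theorem ofReal_tiltedMoment (ν : ℕ) (a : ℝ) :
    ENNReal.ofReal (tiltedMoment ν a) =
      ∫⁻ y in Set.Ioi (0 : ℝ), ENNReal.ofReal (y ^ ν * Real.exp (a * y - y ^ 2 / 2)) :=
  ofReal_setIntegral_Ioi (integrableOn_tilted ν a) fun y hy => by positivity

theorem tiltedMoment_pos (ν : ℕ) (a : ℝ) : 0 < tiltedMoment ν a := by
  refine (setIntegral_pos_iff_support_of_nonneg_ae ?_ (integrableOn_tilted ν a)).2 ?_
  · filter_upwards [ae_restrict_mem measurableSet_Ioi] with y hy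
    have : (0 : ℝ) < y := hy
    simp only [Pi.zero_apply]
    positivity
  · have : Set.Ioi (0 : ℝ) ⊆
        Function.support (fun y : ℝ => y ^ ν * Real.exp (a * y - y ^ 2 / 2)) := by
      intro y hy
      have : (0 : ℝ) < y := hy
      simp only [Function.mem_support]
      positivity
    rw [Set.inter_eq_self_of_subset_right this]
    simp

theorem monotone_tiltedMoment (ν : ℕ) : Monotone (tiltedMoment ν) := by
  intro a b hab
  refine setIntegral_mono_on (integrableOn_tilted ν a) (integrableOn_tilted ν b)
    measurableSet_Ioi fun y hy => ?_
  have : (0 : ℝ) < y := hy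
  gcongr

@[fun_prop]
theorem measurable_tiltedMoment (ν : ℕ) : Measurable (tiltedMoment ν) :=
  (monotone_tiltedMoment ν).measurable

/-- The rearrangement inequality in `ℝ≥0∞`, where addition is not cancellative. -/
theorem mul_add_mul_le_of_le_of_le {a b c e : ℝ≥0∞} (hab : a ≤ b) (hce : c ≤ e) :
    a * e + b * c ≤ a * c + b * e := by
  obtain ⟨s, rfl⟩ := exists_add_of_le hab
  obtain ⟨t, rfl⟩ := exists_add_of_le hce
  calc a * (c + t) + (a + s) * c ≤ a * (c + t) + (a + s) * c + s * t := le_self_add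
    _ = _ := by ring

/-- Chebyshev's integral inequality: two nondecreasing functions are nonnegatively correlated.
Integrate `f x g y + f y g x ≤ f x g x + f y g y` over both variables. -/
theorem lintegral_mul_lintegral_le_of_monotone {μ : Measure ℝ} [SFinite μ] {f g : ℝ → ℝ≥0∞}
    (hf : Monotone f) (hg : Monotone g) :
    (∫⁻ x, f x ∂μ) * ∫⁻ x, g x ∂μ ≤ μ Set.univ * ∫⁻ x, f x * g x ∂μ := by
  have hfm := hf.measurable
  have hgm := hg.measurable
  have key : ∀ x y, f x * g y + f y * g x ≤ f x * g x + f y * g y := by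
    intro x y
    rcases le_total x y with h | h
    · exact mul_add_mul_le_of_le_of_le (hf h) (hg h)
    · rw [add_comm, add_comm (f x * g x)]
      exact mul_add_mul_le_of_le_of_le (hf h) (hg h)
  have h2 := lintegral_mono (μ := μ) fun x => lintegral_mono (μ := μ) fun y => key x y
  have e1 : ∀ x, ∫⁻ y, (f x * g y + f y * g x) ∂μ =
      f x * ∫⁻ y, g y ∂μ + (∫⁻ y, f y ∂μ) * g x := fun x => by
    rw [lintegral_add_left (by fun_prop), lintegral_const_mul _ hgm, lintegral_mul_const _ hfm]
  have e2 : ∀ x, ∫⁻ y, (f x * g x + f y * g y) ∂μ =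
      f x * g x * μ Set.univ + ∫⁻ y, f y * g y ∂μ := fun x => by
    rw [lintegral_add_left (by fun_prop), lintegral_const]
  simp only [e1, e2] at h2
  rw [lintegral_add_left (by fun_prop), lintegral_add_left (by fun_prop),
    lintegral_mul_const _ hfm, lintegral_const_mul _ hgm, lintegral_mul_const _ (by fun_prop),
    lintegral_const, ← two_mul, mul_comm (∫⁻ y, f y * g y ∂μ), ← two_mul] at h2
  exact (ENNReal.mul_le_mul_iff_right two_ne_zero ENNReal.ofNat_ne_top).1 h2

/-- Total positivity of the exponential tilts of two Gaussian weights: flattening the weight from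
`e ^ (-y² / 2)` to `e ^ (-c y² / 2)` favours the larger tilt. -/
theorem moment_mul_moment_le (ν : ℕ) {a b c : ℝ} (hab : a ≤ b) (hc : 0 < c) (hc1 : c ≤ 1) :
    tiltedMoment ν b *
        (∫ y in Set.Ioi (0 : ℝ), y ^ ν * Real.exp (a * y - c * (y ^ 2 / 2))) ≤
      tiltedMoment ν a *
        ∫ y in Set.Ioi (0 : ℝ), y ^ ν * Real.exp (b * y - c * (y ^ 2 / 2)) := by
  set w : ℝ → ℝ≥0∞ := fun y => ENNReal.ofReal (y ^ ν * Real.exp (a * y - y ^ 2 / 2)) with hw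
  have hwm : Measurable w := by fun_prop
  set μ : Measure ℝ := (volume.restrict (Set.Ioi 0)).withDensity w with hμ
  set f : ℝ → ℝ≥0∞ := fun y => ENNReal.ofReal (Real.exp ((b - a) * y)) with hf
  -- truncating at `0` makes the exponent monotone on the whole line
  set g : ℝ → ℝ≥0∞ := fun y => ENNReal.ofReal (Real.exp ((1 - c) * ((max y 0) ^ 2 / 2))) with hg
  have hfm : Monotone f := by
    intro x y h
    have : 0 ≤ b - a := sub_nonneg.2 hab
    simp only [hf]
    gcongr
  have hgm : Monotone g := by
    intro x y h
    have : 0 ≤ 1 - c := sub_nonneg.2 hc1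
    simp only [hg]
    gcongr
  have hfmeas := hfm.measurable
  have hgmeas := hgm.measurable
  have key := lintegral_mul_lintegral_le_of_monotone (μ := μ) hfm hgm
  have hmul : ∀ F : ℝ → ℝ≥0∞, Measurable F → ∀ G : ℝ → ℝ,
      IntegrableOn G (Set.Ioi 0) → (∀ y, 0 < y → 0 ≤ G y) →
      (∀ y, 0 < y → w y * F y = ENNReal.ofReal (G y)) →
      ∫⁻ y, F y ∂μ = ENNReal.ofReal (∫ y in Set.Ioi (0 : ℝ), G y) := by
    intro F hF G hG hG0 h
    rw [hμ, lintegral_withDensity_eq_lintegral_mul _ hwm hF, ofReal_setIntegral_Ioi hG hG0]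
    exact setLIntegral_congr_fun measurableSet_Ioi fun y hy => h y hy
  have h1 := hmul f hfmeas _ (integrableOn_tilted ν b) (fun y hy => by positivity) fun y hy => by
    simp only [hw, hf]
    rw [← ENNReal.ofReal_mul (by positivity), mul_assoc, ← Real.exp_add]
    ring_nf
  have h2 := hmul g hgmeas _ (integrableOn_pow_mul_exp ν a hc) (fun y hy => by positivity)
    fun y hy => by
      simp only [hw, hg]
      rw [max_eq_left hy.le, ← ENNReal.ofReal_mul (by positivity), mul_assoc, ← Real.exp_add]
      ring_nf
  have h3 := hmul (fun y => f y * g y) (by fun_prop) _ (integrableOn_pow_mul_exp ν b hc)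
    (fun y hy => by positivity) fun y hy => by
      simp only [hw, hf, hg]
      rw [max_eq_left hy.le, ← ENNReal.ofReal_mul (by positivity),
        ← ENNReal.ofReal_mul (by positivity), mul_assoc, ← Real.exp_add, ← Real.exp_add]
      ring_nf
  have h4 := hmul (fun _ => 1) (by fun_prop) _ (integrableOn_tilted ν a)
    (fun y hy => by positivity) fun y hy => by simp only [hw, mul_one]
  rw [lintegral_one] at h4
  have hnn : ∀ t : ℝ, 0 ≤ ∫ y in Set.Ioi (0 : ℝ), y ^ ν * Real.exp (t * y - c * (y ^ 2 / 2)) :=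
    fun t => setIntegral_nonneg measurableSet_Ioi fun y hy => by
      have : (0 : ℝ) < y := hy
      positivity
  rw [h1, h2, h3, h4] at key
  change ENNReal.ofReal (tiltedMoment ν b) * _ ≤ ENNReal.ofReal (tiltedMoment ν a) * _ at key
  rw [← ENNReal.ofReal_mul (tiltedMoment_pos ν b).le,
    ← ENNReal.ofReal_mul (tiltedMoment_pos ν a).le] at key
  exact (ENNReal.ofReal_le_ofReal_iff (mul_nonneg (tiltedMoment_pos ν a).le (hnn b))).1 key

/-- The change of variables `y = c u`. -/
theorem tiltedMoment_div (ν : ℕ) (a : ℝ) {c : ℝ} (hc : 0 < c) :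
    tiltedMoment ν (a / c) = c ^ (ν + 1) *
      ∫ u in Set.Ioi (0 : ℝ), u ^ ν * Real.exp (a * u - c ^ 2 * (u ^ 2 / 2)) := by
  have h := integral_comp_mul_left_Ioi
    (fun y : ℝ => y ^ ν * Real.exp (a / c * y - y ^ 2 / 2)) 0 hc
  rw [mul_zero, smul_eq_mul] at h
  rw [tiltedMoment, ← mul_right_inj' (inv_ne_zero hc.ne'), ← h, ← integral_const_mul,
    ← integral_const_mul]
  refine setIntegral_congr_fun measurableSet_Ioi fun u _ => ?_
  have e : a / c * (c * u) - (c * u) ^ 2 / 2 = a * u - c ^ 2 * (u ^ 2 / 2) := by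
    field_simp
  simp only [e]
  rw [mul_pow, pow_succ c ν, mul_comm (c ^ ν) c, mul_assoc c, inv_mul_cancel_left₀ hc.ne',
    mul_assoc]

/-- The ratio of tilted moments is nondecreasing on the positive half-line, in product
form. -/
theorem tiltedMoment_mul_le (ν : ℕ) {a b s t : ℝ} (hab : a ≤ b) (hs : 0 < s) (hst : s ≤ t) :
    tiltedMoment ν (b * s) * tiltedMoment ν (a * t) ≤
      tiltedMoment ν (a * s) * tiltedMoment ν (b * t) := by
  have ht : 0 < t := hs.trans_le hst
  have hr : 0 < s / t := div_pos hs ht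
  -- rescaling by `s / t` turns the tilt `l t` into `l s` and flattens the Gaussian weight
  have hsub : ∀ l : ℝ, tiltedMoment ν (l * t) = (s / t) ^ (ν + 1) *
      ∫ u in Set.Ioi (0 : ℝ), u ^ ν * Real.exp (l * s * u - (s / t) ^ 2 * (u ^ 2 / 2)) := by
    intro l
    rw [← tiltedMoment_div ν _ hr]
    congr 1
    field_simp
  rw [hsub a, hsub b]
  have := moment_mul_moment_le ν (mul_le_mul_of_nonneg_right hab hs.le)
    (pow_pos hr 2) (pow_le_one₀ hr.le ((div_le_one ht).2 hst))
  calc _ = (s / t) ^ (ν + 1) * (tiltedMoment ν (b * s) * ∫ u in Set.Ioi (0 : ℝ),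
        u ^ ν * Real.exp (a * s * u - (s / t) ^ 2 * (u ^ 2 / 2))) := by ring
    _ ≤ (s / t) ^ (ν + 1) * (tiltedMoment ν (a * s) * ∫ u in Set.Ioi (0 : ℝ),
        u ^ ν * Real.exp (b * s * u - (s / t) ^ 2 * (u ^ 2 / 2))) := by gcongr
    _ = _ := by ring

/-- The ratio of tilted moments has value `1` at `0`; it is nondecreasing on the positive half-line
by total positivity, and on the negative one by the symmetry `(a, b, s) ↦ (-b, -a, -s)`. -/
theorem monotone_tiltedMoment_ratio (ν : ℕ) {a b : ℝ} (hab : a ≤ b) :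
    Monotone fun s => tiltedMoment ν (b * s) / tiltedMoment ν (a * s) := by
  have hpos := tiltedMoment_pos ν
  have hmono := monotone_tiltedMoment ν
  have h1 : ∀ s : ℝ, 0 ≤ s → 1 ≤ tiltedMoment ν (b * s) / tiltedMoment ν (a * s) := fun s hs =>
    (one_le_div (hpos _)).2 (hmono (mul_le_mul_of_nonneg_right hab hs))
  have h2 : ∀ s : ℝ, s ≤ 0 → tiltedMoment ν (b * s) / tiltedMoment ν (a * s) ≤ 1 := fun s hs =>
    (div_le_one (hpos _)).2 (hmono (mul_le_mul_of_nonpos_right hab hs))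
  intro s t hst
  rcases le_or_gt s 0 with hs | hs
  · rcases le_or_gt 0 t with ht | ht
    · exact (h2 s hs).trans (h1 t ht)
    · have := tiltedMoment_mul_le ν (neg_le_neg hab) (neg_pos.2 ht) (neg_le_neg hst)
      simp only [neg_mul_neg] at this
      change _ / _ ≤ _ / _
      rw [div_le_div_iff₀ (hpos _) (hpos _)]
      linarith
  · have := tiltedMoment_mul_le ν hab hs hst
    change _ / _ ≤ _ / _
    rw [div_le_div_iff₀ (hpos _) (hpos _)]
    linarith

/-! ### The noncentral `t` density -/

/-- The part of the noncentral `t` density that does not depend on the noncentrality. -/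
def tNormalizer (ν : ℕ) (t : ℝ) : ℝ :=
  (ν : ℝ) ^ ((ν : ℝ) / 2) /
    (√Real.pi * Real.Gamma ((ν : ℝ) / 2) * 2 ^ (((ν : ℝ) - 1) / 2) *
      (t ^ 2 + ν) ^ (((ν : ℝ) + 1) / 2))

theorem noncentralTPDF_eq {ν : ℕ} (hν : 1 ≤ ν) (lam t : ℝ) :
    noncentralTPDF ν lam t = tNormalizer ν t *
      (Real.exp (-lam ^ 2 / 2) * tiltedMoment ν (lam * (t / √(t ^ 2 + ν)))) := by
  have hν' : (0 : ℝ) < ν := by exact_mod_cast hν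
  have hpos : 0 < t ^ 2 + (ν : ℝ) := by positivity
  have hs : (t / √(t ^ 2 + ν)) ^ 2 = t ^ 2 / (t ^ 2 + ν) := by
    rw [div_pow, Real.sq_sqrt hpos.le]
  set s := t / √(t ^ 2 + ν) with hsdef
  have hint : ∫ y in Set.Ioi (0 : ℝ), y ^ ν * Real.exp (-(y - lam * t / √(t ^ 2 + ν)) ^ 2 / 2) =
      Real.exp (-(lam * s) ^ 2 / 2) * tiltedMoment ν (lam * s) := by
    rw [tiltedMoment, ← integral_const_mul]
    refine setIntegral_congr_fun measurableSet_Ioi fun y _ => ?_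
    rw [mul_left_comm, ← Real.exp_add, mul_div_assoc, ← hsdef]
    ring_nf
  have hexp : Real.exp (-(ν * lam ^ 2) / (2 * (t ^ 2 + ν))) * Real.exp (-(lam * s) ^ 2 / 2) =
      Real.exp (-lam ^ 2 / 2) := by
    rw [← Real.exp_add, mul_pow, hs]
    congr 1
    field_simp
    ring
  rw [noncentralTPDF, hint, tNormalizer, ← hexp]
  ring

theorem tNormalizer_pos {ν : ℕ} (hν : 1 ≤ ν) (t : ℝ) : 0 < tNormalizer ν t := by
  have hν' : (0 : ℝ) < ν := by exact_mod_cast hν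
  have := Real.Gamma_pos_of_pos (half_pos hν')
  unfold tNormalizer
  positivity

theorem noncentralTPDF_pos {ν : ℕ} (hν : 1 ≤ ν) (lam t : ℝ) : 0 < noncentralTPDF ν lam t := by
  rw [noncentralTPDF_eq hν]
  have := tNormalizer_pos hν t
  have := tiltedMoment_pos ν (lam * (t / √(t ^ 2 + ν)))
  positivity

theorem noncentralTPDF_div {ν : ℕ} (hν : 1 ≤ ν) (lam₀ lamp t : ℝ) :
    noncentralTPDF ν lamp t / noncentralTPDF ν lam₀ t =
      Real.exp (-lamp ^ 2 / 2) / Real.exp (-lam₀ ^ 2 / 2) *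
        (tiltedMoment ν (lamp * (t / √(t ^ 2 + ν))) /
          tiltedMoment ν (lam₀ * (t / √(t ^ 2 + ν)))) := by
  rw [noncentralTPDF_eq hν, noncentralTPDF_eq hν, mul_div_mul_left _ _ (tNormalizer_pos hν t).ne',
    mul_div_mul_comm]

theorem monotone_div_sqrt_sq_add {c : ℝ} (hc : 0 < c) :
    Monotone fun t : ℝ => t / √(t ^ 2 + c) := by
  intro s t hst
  change s / √(s ^ 2 + c) ≤ t / √(t ^ 2 + c)
  have hs : 0 < s ^ 2 + c := by positivity
  have ht : 0 < t ^ 2 + c := by positivity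
  rw [div_le_div_iff₀ (Real.sqrt_pos.2 hs) (Real.sqrt_pos.2 ht)]
  rcases le_total 0 s with h0 | h0
  · have h1 : 0 ≤ t := h0.trans hst
    rw [← Real.sqrt_sq h0, ← Real.sqrt_sq h1, ← Real.sqrt_mul (sq_nonneg s),
      ← Real.sqrt_mul (sq_nonneg t), Real.sqrt_sq h0, Real.sqrt_sq h1]
    exact Real.sqrt_le_sqrt (by nlinarith [pow_le_pow_left₀ h0 hst 2])
  · rcases le_total 0 t with h1 | h1
    · exact (mul_nonpos_of_nonpos_of_nonneg h0 (Real.sqrt_nonneg _)).trans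
        (mul_nonneg h1 (Real.sqrt_nonneg _))
    · have h0' := neg_nonneg.2 h0
      have h1' := neg_nonneg.2 h1
      have : -t * √(s ^ 2 + c) ≤ -s * √(t ^ 2 + c) := by
        rw [← Real.sqrt_sq h0', ← Real.sqrt_sq h1', ← Real.sqrt_mul (sq_nonneg _),
          ← Real.sqrt_mul (sq_nonneg _)]
        exact Real.sqrt_le_sqrt (by nlinarith [pow_le_pow_left₀ h1' (neg_le_neg hst) 2])
      linarith

/-- The monotone likelihood ratio property of the noncentral `t` family. -/
theorem monotone_noncentralTPDF_div {ν : ℕ} (hν : 1 ≤ ν) {lam₀ lamp : ℝ} (h : lam₀ ≤ lamp) :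
    Monotone fun t => noncentralTPDF ν lamp t / noncentralTPDF ν lam₀ t := by
  simp only [noncentralTPDF_div hν]
  have hν' : (0 : ℝ) < ν := by exact_mod_cast hν
  exact ((monotone_tiltedMoment_ratio ν h).comp (monotone_div_sqrt_sq_add hν')).const_mul
    (by positivity)

/-- The factors `qFactor` and `tNormalizer` cancel up to the Gaussian normalizing constant. -/
theorem qFactor_mul_tNormalizer {ν : ℕ} (hν : 1 ≤ ν) (t : ℝ) :
    qFactor ν t * tNormalizer ν t = (2 * Real.pi) ^ (-((ν : ℝ) + 1) / 2) := by
  have hν' : (0 : ℝ) < ν := by exact_mod_cast hν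
  have hG := (Real.Gamma_pos_of_pos (half_pos hν')).ne'
  have hpos : 0 < t ^ 2 + (ν : ℝ) := by positivity
  have e1 : (1 + t ^ 2 / (ν : ℝ)) = (t ^ 2 + ν) / ν := by
    field_simp
    ring
  have e2 : (ν : ℝ) ^ (((ν : ℝ) + 1) / 2) = √ν * (ν : ℝ) ^ ((ν : ℝ) / 2) := by
    rw [Real.sqrt_eq_rpow, ← Real.rpow_add hν']
    ring_nf
  have e3 : (2 * Real.pi) ^ (-((ν : ℝ) + 1) / 2) * (2 * 2 ^ (((ν : ℝ) - 1) / 2) * √Real.pi) =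
      Real.pi ^ (-(ν : ℝ) / 2) := by
    have h2 : (2 : ℝ) * 2 ^ (((ν : ℝ) - 1) / 2) = 2 ^ (((ν : ℝ) + 1) / 2) := by
      nth_rewrite 1 [← Real.rpow_one 2]
      rw [← Real.rpow_add two_pos]
      ring_nf
    rw [Real.mul_rpow two_pos.le Real.pi_pos.le, h2, Real.sqrt_eq_rpow, mul_mul_mul_comm,
      ← Real.rpow_add two_pos, ← Real.rpow_add Real.pi_pos]
    ring_nf
    rw [Real.rpow_zero, one_mul]
  have h1 := (Real.rpow_pos_of_pos hpos (((ν : ℝ) + 1) / 2)).ne'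
  have h2 := (Real.rpow_pos_of_pos hν' ((ν : ℝ) / 2)).ne'
  have h3 := (Real.rpow_pos_of_pos two_pos (((ν : ℝ) - 1) / 2)).ne'
  have h4 := (Real.sqrt_pos.2 hν').ne'
  have h5 := (Real.sqrt_pos.2 Real.pi_pos).ne'
  rw [qFactor, tNormalizer, e1, Real.div_rpow hpos.le hν'.le, e2, ← e3]
  field_simp

/-! ### Gaussian vectors in polar coordinates -/

theorem integrable_exp_neg_norm_sq_div_two (k : ℕ) :
    Integrable fun w : EuclideanSpace ℝ (Fin k) => Real.exp (-‖w‖ ^ 2 / 2) := by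
  have h := (GaussianFourier.integrable_cexp_neg_mul_sq_norm_add (b := 1 / 2) (by norm_num) 0
    (0 : EuclideanSpace ℝ (Fin k))).re
  refine h.congr (Filter.Eventually.of_forall fun w => ?_)
  have : (-(1 / 2 : ℂ) * (‖w‖ : ℂ) ^ 2 + 0 * ((inner ℝ (0 : EuclideanSpace ℝ (Fin k)) w : ℝ) : ℂ)) =
      ((-‖w‖ ^ 2 / 2 : ℝ) : ℂ) := by
    push_cast
    ring
  simp only [this]
  exact Complex.exp_ofReal_re _

/-- The Lebesgue density of the standard Gaussian measure, by comparison of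
characteristic functions. -/
theorem stdGaussian_eq_withDensity (k : ℕ) :
    stdGaussian (EuclideanSpace ℝ (Fin k)) = volume.withDensity fun w =>
      ENNReal.ofReal ((2 * Real.pi) ^ (-(k : ℝ) / 2) * Real.exp (-‖w‖ ^ 2 / 2)) := by
  set C : ℝ := (2 * Real.pi) ^ (-(k : ℝ) / 2) with hC
  have hC0 : 0 < C := by positivity
  have hint := (integrable_exp_neg_norm_sq_div_two k).const_mul C
  have : IsFiniteMeasure ((volume : Measure (EuclideanSpace ℝ (Fin k))).withDensity fun w =>
      ENNReal.ofReal (C * Real.exp (-‖w‖ ^ 2 / 2))) := isFiniteMeasure_withDensity_ofReal hint.2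
  refine Measure.ext_of_charFun ?_
  ext t
  have hm : Measurable fun w : EuclideanSpace ℝ (Fin k) =>
      ENNReal.ofReal (C * Real.exp (-‖w‖ ^ 2 / 2)) := by fun_prop
  rw [charFun_stdGaussian, charFun_apply, integral_withDensity_eq_integral_toReal_smul hm
    (Filter.Eventually.of_forall fun _ => ENNReal.ofReal_lt_top)]
  have e : ∀ w : EuclideanSpace ℝ (Fin k),
      (ENNReal.ofReal (C * Real.exp (-‖w‖ ^ 2 / 2))).toReal •
        Complex.exp ((inner ℝ w t : ℝ) * Complex.I) =
      (C : ℂ) * Complex.exp (-(1 / 2 : ℂ) * (‖w‖ : ℂ) ^ 2 + Complex.I * (inner ℝ t w : ℝ)) := by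
    intro w
    rw [ENNReal.toReal_ofReal (by positivity), Complex.real_smul, Complex.exp_add,
      real_inner_comm t w]
    push_cast
    ring_nf
  simp_rw [e]
  rw [integral_const_mul, GaussianFourier.integral_cexp_neg_mul_sq_norm_add (by norm_num),
    finrank_euclideanSpace, Fintype.card_fin, ← mul_assoc]
  have h1 : (C : ℂ) * ((Real.pi : ℂ) / (1 / 2)) ^ ((k : ℂ) / 2) = 1 := by
    have : ((Real.pi : ℂ) / (1 / 2)) ^ ((k : ℂ) / 2) =
        (((2 * Real.pi) ^ ((k : ℝ) / 2) : ℝ) : ℂ) := by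
      rw [Complex.ofReal_cpow (by positivity)]
      push_cast
      congr 1
      ring
    rw [this, ← Complex.ofReal_mul, hC, ← Real.rpow_add (by positivity), neg_div, neg_add_cancel,
      Real.rpow_zero, Complex.ofReal_one]
  rw [h1, one_mul, Complex.I_sq]
  congr 1
  ring

theorem ae_norm_eq_one_sphereMeasure (k : ℕ) : ∀ᵐ u ∂sphereMeasure k, ‖u‖ = 1 := by
  rw [sphereMeasure, ae_map_iff measurable_subtype_coe.aemeasurable
    (measurableSet_eq_fun measurable_norm measurable_const)]
  exact Filter.Eventually.of_forall fun u => norm_eq_of_mem_sphere u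

instance isFiniteMeasure_sphereMeasure (k : ℕ) : IsFiniteMeasure (sphereMeasure k) := by
  unfold sphereMeasure
  infer_instance

/-- Integration in polar coordinates. -/
theorem lintegral_eq_lintegral_sphereMeasure {k : ℕ} {F : EuclideanSpace ℝ (Fin k) → ℝ≥0∞}
    (hk : 1 ≤ k) (hF : Measurable F) :
    ∫⁻ w, F w = ∫⁻ u, (∫⁻ r in Set.Ioi (0 : ℝ), ENNReal.ofReal (r ^ (k - 1)) * F (r • u))
      ∂sphereMeasure k := by
  have : Nonempty (Fin k) := ⟨⟨0, hk⟩⟩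
  have hmp :=
    (volume : Measure (EuclideanSpace ℝ (Fin k))).measurePreserving_homeomorphUnitSphereProd
  have h1 : ∫⁻ w, F w =
      ∫⁻ x : ({(0 : EuclideanSpace ℝ (Fin k))}ᶜ : Set (EuclideanSpace ℝ (Fin k))), F x
        ∂(volume.comap Subtype.val) := by
    rw [lintegral_subtype_comap (measurableSet_singleton _).compl, restrict_compl_singleton]
  have h2 : ∫⁻ x : ({(0 : EuclideanSpace ℝ (Fin k))}ᶜ : Set (EuclideanSpace ℝ (Fin k))), F x
        ∂(volume.comap Subtype.val) =
      ∫⁻ p : Metric.sphere (0 : EuclideanSpace ℝ (Fin k)) 1 × Set.Ioi (0 : ℝ), F (p.2.1 • p.1.1)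
        ∂((volume : Measure (EuclideanSpace ℝ (Fin k))).toSphere.prod
          (Measure.volumeIoiPow (k - 1))) := by
    have hd : Module.finrank ℝ (EuclideanSpace ℝ (Fin k)) = k := by simp
    rw [hd] at hmp
    rw [← hmp.lintegral_comp (by fun_prop)]
    refine lintegral_congr fun x => ?_
    congr 1
    have := congrArg Subtype.val
      ((homeomorphUnitSphereProd (EuclideanSpace ℝ (Fin k))).symm_apply_apply x)
    rw [← this]
    rfl
  rw [h1, h2, lintegral_prod _ (by fun_prop), sphereMeasure, lintegral_map (by fun_prop)
    measurable_subtype_coe]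
  refine lintegral_congr fun u => ?_
  rw [Measure.volumeIoiPow, lintegral_withDensity_eq_lintegral_mul _ (by fun_prop) (by fun_prop)]
  exact lintegral_subtype_comap measurableSet_Ioi
    (fun r : ℝ => ENNReal.ofReal (r ^ (k - 1)) * F (r • u.1))

/-- The density, relative to surface measure, of the direction of a Gaussian vector with identity
covariance and mean `m` in `ℝᵏ`. -/
def directionDensity {k : ℕ} (m u : EuclideanSpace ℝ (Fin k)) : ℝ :=
  (2 * Real.pi) ^ (-(k : ℝ) / 2) * Real.exp (-‖m‖ ^ 2 / 2) * tiltedMoment (k - 1) (inner ℝ m u)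

theorem directionDensity_pos {k : ℕ} (m u : EuclideanSpace ℝ (Fin k)) :
    0 < directionDensity m u := by
  have := tiltedMoment_pos (k - 1) (inner ℝ m u)
  unfold directionDensity
  positivity

@[fun_prop]
theorem measurable_directionDensity {k : ℕ} (m : EuclideanSpace ℝ (Fin k)) :
    Measurable (directionDensity m) := by
  unfold directionDensity
  fun_prop

/-- In polar coordinates `w = r u` the integral over `r` is a tilted moment. -/
theorem map_normalize_stdGaussian {k : ℕ} (hk : 1 ≤ k) (m : EuclideanSpace ℝ (Fin k)) :
    (stdGaussian (EuclideanSpace ℝ (Fin k))).map (fun w => ‖w + m‖⁻¹ • (w + m)) =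
      (sphereMeasure k).withDensity fun u => ENNReal.ofReal (directionDensity m u) := by
  set C : ℝ := (2 * Real.pi) ^ (-(k : ℝ) / 2) with hC
  have hC0 : 0 < C := by positivity
  refine Measure.ext_of_lintegral _ fun f hf => ?_
  rw [lintegral_map hf (by fun_prop), stdGaussian_eq_withDensity,
    lintegral_withDensity_eq_lintegral_mul _ (by fun_prop) (by fun_prop),
    lintegral_withDensity_eq_lintegral_mul _ (by fun_prop) hf]
  simp only [Pi.mul_apply]
  have htr := lintegral_add_right_eq_self (μ := (volume : Measure (EuclideanSpace ℝ (Fin k))))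
    (fun w => ENNReal.ofReal (C * Real.exp (-‖w - m‖ ^ 2 / 2)) * f (‖w‖⁻¹ • w)) m
  simp only [add_sub_cancel_right] at htr
  rw [htr, lintegral_eq_lintegral_sphereMeasure hk (by fun_prop)]
  refine lintegral_congr_ae ?_
  filter_upwards [ae_norm_eq_one_sphereMeasure k] with u hu
  have hr : ∀ r ∈ Set.Ioi (0 : ℝ),
      ENNReal.ofReal (r ^ (k - 1)) * (ENNReal.ofReal (C * Real.exp (-‖r • u - m‖ ^ 2 / 2)) *
        f (‖r • u‖⁻¹ • r • u)) =
      ENNReal.ofReal (C * Real.exp (-‖m‖ ^ 2 / 2)) * f u *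
        ENNReal.ofReal (r ^ (k - 1) * Real.exp (inner ℝ m u * r - r ^ 2 / 2)) := by
    intro r hr
    have hr0 : 0 < r := hr
    have hn : ‖r • u‖⁻¹ • r • u = u := by
      rw [norm_smul, hu, mul_one, Real.norm_of_nonneg hr0.le, inv_smul_smul₀ hr0.ne']
    have he : Real.exp (-‖r • u - m‖ ^ 2 / 2) =
        Real.exp (-‖m‖ ^ 2 / 2) * Real.exp (inner ℝ m u * r - r ^ 2 / 2) := by
      rw [← Real.exp_add, norm_sub_sq_real, norm_smul, hu, Real.norm_of_nonneg hr0.le,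
        real_inner_smul_left, real_inner_comm]
      ring_nf
    rw [hn, he, ENNReal.ofReal_mul hC0.le, ENNReal.ofReal_mul (Real.exp_pos _).le,
      ENNReal.ofReal_mul hC0.le, ENNReal.ofReal_mul (pow_nonneg hr0.le _)]
    ring
  rw [setLIntegral_congr_fun measurableSet_Ioi hr, lintegral_const_mul _ (by fun_prop),
    ← ofReal_tiltedMoment, directionDensity, ← hC,
    ENNReal.ofReal_mul (p := C * Real.exp (-‖m‖ ^ 2 / 2)) (by positivity)]
  ring

/-! ### The density of the noncentral `t` distribution -/

theorem sphereMeasure_univ {k : ℕ} (hk : 1 ≤ k) :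
    sphereMeasure k Set.univ =
      ENNReal.ofReal (2 * Real.pi ^ ((k : ℝ) / 2) / Real.Gamma ((k : ℝ) / 2)) := by
  have : Nonempty (Fin k) := ⟨⟨0, hk⟩⟩
  have hk0 : (0 : ℝ) < (k : ℝ) / 2 := half_pos (by exact_mod_cast hk)
  have hG := Real.Gamma_pos_of_pos hk0
  rw [sphereMeasure, Measure.map_apply measurable_subtype_coe .univ, Set.preimage_univ,
    Measure.toSphere_apply_univ, EuclideanSpace.volume_ball, finrank_euclideanSpace,
    Fintype.card_fin, Real.Gamma_add_one hk0.ne', ENNReal.ofReal_one, one_pow, one_mul,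
    ← ENNReal.ofReal_natCast, ← ENNReal.ofReal_mul (by positivity)]
  congr 1
  rw [Real.sqrt_eq_rpow, ← Real.rpow_natCast, ← Real.rpow_mul Real.pi_pos.le]
  field_simp

/-- The law of `X / a` for `X ∼ N(lam, 1)` and `a > 0`. -/
theorem lintegral_gaussianReal_div {f : ℝ → ℝ≥0∞} (lam : ℝ) {a : ℝ} (ha : 0 < a) :
    ∫⁻ x, f (x / a) ∂gaussianReal lam 1 =
      ∫⁻ t, f t * ENNReal.ofReal
        (a * ((√(2 * Real.pi))⁻¹ * Real.exp (-(t * a - lam) ^ 2 / 2))) := by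
  have hinj : Set.InjOn (fun t : ℝ => t * a) Set.univ := fun s _ t _ h =>
    mul_right_cancel₀ ha.ne' h
  have himg : (fun t : ℝ => t * a) '' Set.univ = Set.univ :=
    Set.image_univ_of_surjective fun x => ⟨x / a, div_mul_cancel₀ x ha.ne'⟩
  have h := lintegral_image_eq_lintegral_abs_deriv_mul MeasurableSet.univ
    (fun t _ => ((hasDerivAt_id t).mul_const a).hasDerivWithinAt) hinj
    (fun x => gaussianPDF lam 1 x * f (x / a))
  rw [gaussianReal_of_var_ne_zero _ one_ne_zero,
    lintegral_withDensity_eq_lintegral_mul_non_measurable _ (measurable_gaussianPDF lam 1)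
      (Filter.Eventually.of_forall fun _ => gaussianPDF_lt_top)]
  simp only [id] at h
  rw [himg] at h
  simp only [Measure.restrict_univ] at h
  simp only [Pi.mul_apply]
  rw [h]
  refine lintegral_congr fun t => ?_
  rw [mul_div_cancel_right₀ _ ha.ne', one_mul, abs_of_pos ha, gaussianPDF, gaussianPDFReal,
    ← mul_assoc, ← ENNReal.ofReal_mul ha.le, mul_comm]
  simp

/-- The density at `t` of `G / (R / √ν)`, with `R` the norm of a standard Gaussian vector in `ℝ^ν`,
as an integral over the values `r` of `R`. -/
theorem lintegral_radial_eq_noncentralTPDF {ν : ℕ} (hν : 1 ≤ ν) (lam t : ℝ) :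
    sphereMeasure ν Set.univ * ∫⁻ r in Set.Ioi (0 : ℝ),
      ENNReal.ofReal (r ^ (ν - 1) * ((2 * Real.pi) ^ (-(ν : ℝ) / 2) * Real.exp (-r ^ 2 / 2)) *
        (r / √ν * ((√(2 * Real.pi))⁻¹ * Real.exp (-(t * (r / √ν) - lam) ^ 2 / 2)))) =
      ENNReal.ofReal (noncentralTPDF ν lam t) := by
  have hν' : (0 : ℝ) < ν := by exact_mod_cast hν
  have hG := Real.Gamma_pos_of_pos (half_pos hν')
  have hsν : 0 < √(ν : ℝ) := Real.sqrt_pos.2 hν'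
  have hpos : 0 < t ^ 2 + (ν : ℝ) := by positivity
  have hst : 0 < √(t ^ 2 + ν) := Real.sqrt_pos.2 hpos
  set c : ℝ := √(t ^ 2 + ν) / √ν with hc
  have hc0 : 0 < c := div_pos hst hsν
  have hc2 : c ^ 2 = (t ^ 2 + ν) / ν := by
    rw [hc, div_pow, Real.sq_sqrt hpos.le, Real.sq_sqrt hν'.le]
  set K : ℝ := (2 * Real.pi) ^ (-(ν : ℝ) / 2) * (√ν)⁻¹ * (√(2 * Real.pi))⁻¹ *
    Real.exp (-lam ^ 2 / 2) with hK
  have hint := integrableOn_pow_mul_exp ν (lam * t / √ν) (pow_pos hc0 2)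
  have e : ∀ r ∈ Set.Ioi (0 : ℝ),
      ENNReal.ofReal (r ^ (ν - 1) * ((2 * Real.pi) ^ (-(ν : ℝ) / 2) * Real.exp (-r ^ 2 / 2)) *
        (r / √ν * ((√(2 * Real.pi))⁻¹ * Real.exp (-(t * (r / √ν) - lam) ^ 2 / 2)))) =
      ENNReal.ofReal (K * (r ^ ν * Real.exp (lam * t / √ν * r - c ^ 2 * (r ^ 2 / 2)))) := by
    intro r _
    have e1 : Real.exp (-r ^ 2 / 2) * Real.exp (-(t * (r / √ν) - lam) ^ 2 / 2) =
        Real.exp (-lam ^ 2 / 2) * Real.exp (lam * t / √ν * r - c ^ 2 * (r ^ 2 / 2)) := by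
      rw [← Real.exp_add, ← Real.exp_add, hc2]
      congr 1
      have : (ν : ℝ) = √ν ^ 2 := (Real.sq_sqrt hν'.le).symm
      rw [sub_sq, mul_pow, div_pow, ← this]
      field_simp
      ring
    have e2 : r ^ ν = r ^ (ν - 1) * r := by
      rw [← pow_succ, Nat.sub_add_cancel hν]
    congr 1
    rw [e2, hK]
    calc _ = r ^ (ν - 1) * r * (2 * Real.pi) ^ (-(ν : ℝ) / 2) * (√ν)⁻¹ * (√(2 * Real.pi))⁻¹ *
          (Real.exp (-r ^ 2 / 2) * Real.exp (-(t * (r / √ν) - lam) ^ 2 / 2)) := by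
            rw [div_eq_mul_inv r]; ring
      _ = _ := by rw [e1]; ring
  rw [setLIntegral_congr_fun measurableSet_Ioi e,
    ← ofReal_setIntegral_Ioi (hint.const_mul K) (fun y hy => by positivity), integral_const_mul,
    sphereMeasure_univ hν, ← ENNReal.ofReal_mul (by positivity), noncentralTPDF_eq hν]
  congr 1
  have hdiv : lam * (t / √(t ^ 2 + ν)) = lam * t / √ν / c := by
    rw [hc]
    field_simp
  rw [hdiv, tiltedMoment_div ν _ hc0]
  have hcpow : c ^ (ν + 1) =
      (t ^ 2 + ν) ^ (((ν : ℝ) + 1) / 2) / (√ν * (ν : ℝ) ^ ((ν : ℝ) / 2)) := by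
    have h1 : c ^ (ν + 1) = (c ^ 2) ^ (((ν : ℝ) + 1) / 2) := by
      rw [← Real.rpow_natCast, ← Real.rpow_natCast, ← Real.rpow_mul hc0.le]
      congr 1
      push_cast
      ring
    rw [h1, hc2, Real.div_rpow hpos.le hν'.le, add_div, Real.rpow_add hν', ← Real.sqrt_eq_rpow,
      mul_comm (√(ν : ℝ))]
  have h2π : (2 * Real.pi) ^ (-(ν : ℝ) / 2) * (√(2 * Real.pi))⁻¹ *
      (2 * Real.pi ^ ((ν : ℝ) / 2)) * (√Real.pi * 2 ^ (((ν : ℝ) - 1) / 2)) = 1 := by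
    have h2 : (2 : ℝ) * 2 ^ (((ν : ℝ) - 1) / 2) = √2 * 2 ^ ((ν : ℝ) / 2) := by
      nth_rewrite 1 [← Real.rpow_one 2]
      rw [Real.sqrt_eq_rpow, ← Real.rpow_add two_pos, ← Real.rpow_add two_pos]
      ring_nf
    have h3 : (2 * Real.pi) ^ (-(ν : ℝ) / 2) * ((2 : ℝ) ^ ((ν : ℝ) / 2) * Real.pi ^ ((ν : ℝ) / 2)) =
        1 := by
      rw [← Real.mul_rpow two_pos.le Real.pi_pos.le, ← Real.rpow_add (by positivity), neg_div,
        neg_add_cancel, Real.rpow_zero]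
    have h4 : (√(2 * Real.pi))⁻¹ * (√2 * √Real.pi) = 1 := by
      rw [← Real.sqrt_mul two_pos.le, inv_mul_cancel₀ (Real.sqrt_pos.2 (by positivity)).ne']
    calc _ = (2 * Real.pi) ^ (-(ν : ℝ) / 2) * (√(2 * Real.pi))⁻¹ * Real.pi ^ ((ν : ℝ) / 2) *
          √Real.pi * (2 * 2 ^ (((ν : ℝ) - 1) / 2)) := by ring
      _ = ((2 * Real.pi) ^ (-(ν : ℝ) / 2) * (2 ^ ((ν : ℝ) / 2) * Real.pi ^ ((ν : ℝ) / 2))) *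
          ((√(2 * Real.pi))⁻¹ * (√2 * √Real.pi)) := by rw [h2]; ring
      _ = 1 := by rw [h3, h4, one_mul]
  have p1 := (Real.rpow_pos_of_pos hpos (((ν : ℝ) + 1) / 2)).ne'
  have p2 := (Real.rpow_pos_of_pos hν' ((ν : ℝ) / 2)).ne'
  have p3 := (Real.rpow_pos_of_pos two_pos (((ν : ℝ) - 1) / 2)).ne'
  have p5 := (Real.sqrt_pos.2 Real.pi_pos).ne'
  -- the constants agree by `h2π`
  have hconst : tNormalizer ν t * c ^ (ν + 1) = 2 * Real.pi ^ ((ν : ℝ) / 2) /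
      Real.Gamma ((ν : ℝ) / 2) * ((2 * Real.pi) ^ (-(ν : ℝ) / 2) * (√ν)⁻¹ *
        (√(2 * Real.pi))⁻¹) := by
    rw [hcpow, tNormalizer, ← mul_one (2 * Real.pi ^ ((ν : ℝ) / 2) / _ * _)]
    have h2π' : (2 * Real.pi) ^ (-(ν : ℝ) / 2) * (√(2 * Real.pi))⁻¹ *
        (2 * Real.pi ^ ((ν : ℝ) / 2)) = (√Real.pi * 2 ^ (((ν : ℝ) - 1) / 2))⁻¹ :=
      eq_inv_of_mul_eq_one_left h2π
    calc _ = (Real.Gamma ((ν : ℝ) / 2))⁻¹ * (√ν)⁻¹ *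
          (√Real.pi * 2 ^ (((ν : ℝ) - 1) / 2))⁻¹ := by field_simp
      _ = _ := by rw [← h2π']; ring
  calc _ = 2 * Real.pi ^ ((ν : ℝ) / 2) / Real.Gamma ((ν : ℝ) / 2) *
        ((2 * Real.pi) ^ (-(ν : ℝ) / 2) * (√ν)⁻¹ * (√(2 * Real.pi))⁻¹) *
        (Real.exp (-lam ^ 2 / 2) * ∫ u in Set.Ioi (0 : ℝ),
          u ^ ν * Real.exp (lam * t / √ν * u - c ^ 2 * (u ^ 2 / 2))) := by rw [hK]; ring
    _ = _ := by rw [← hconst]; ring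

/-- The `χ²` variable is the squared norm of a standard Gaussian vector. -/
theorem lintegral_noncentralT (ν : ℕ) (lam : ℝ) {f : ℝ → ℝ≥0∞} (hf : Measurable f) :
    ∫⁻ t, f t ∂noncentralT ν lam = ∫⁻ w : EuclideanSpace ℝ (Fin ν),
      ∫⁻ x, f (x / (‖w‖ / √ν)) ∂gaussianReal lam 1 ∂stdGaussian (EuclideanSpace ℝ (Fin ν)) := by
  have hnorm : ∀ v : Fin ν → ℝ, √((∑ i, v i ^ 2) / ν) = ‖WithLp.toLp 2 v‖ / √ν := by
    intro v
    rw [EuclideanSpace.norm_eq, Real.sqrt_div (Finset.sum_nonneg fun i _ => sq_nonneg _)]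
    simp
  rw [noncentralT, lintegral_map hf (by fun_prop), lintegral_prod_symm _ (by fun_prop),
    ← map_pi_eq_stdGaussian, lintegral_map _ (by fun_prop)]
  · simp only [hnorm]
  · exact Measurable.lintegral_prod_right'
      (f := fun p : EuclideanSpace ℝ (Fin ν) × ℝ => f (p.2 / (‖p.1‖ / √ν))) (by fun_prop)

theorem noncentralT_eq_withDensity {ν : ℕ} (hν : 1 ≤ ν) (lam : ℝ) :
    noncentralT ν lam = volume.withDensity fun t => ENNReal.ofReal (noncentralTPDF ν lam t) := by
  have hν' : (0 : ℝ) < ν := by exact_mod_cast hν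
  have hsν : 0 < √(ν : ℝ) := Real.sqrt_pos.2 hν'
  have hpdf : Measurable fun t => noncentralTPDF ν lam t := by
    simp only [noncentralTPDF_eq hν, tNormalizer]
    fun_prop
  refine Measure.ext_of_lintegral _ fun f hf => ?_
  have hHm : Measurable fun w : EuclideanSpace ℝ (Fin ν) =>
      ∫⁻ x, f (x / (‖w‖ / √ν)) ∂gaussianReal lam 1 :=
    Measurable.lintegral_prod_right'
      (f := fun p : EuclideanSpace ℝ (Fin ν) × ℝ => f (p.2 / (‖p.1‖ / √ν))) (by fun_prop)
  obtain ⟨g, hg⟩ : ∃ g : ℝ → ℝ → ℝ, g = fun r t =>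
    r ^ (ν - 1) * ((2 * Real.pi) ^ (-(ν : ℝ) / 2) * Real.exp (-r ^ 2 / 2)) *
      (r / √ν * ((√(2 * Real.pi))⁻¹ * Real.exp (-(t * (r / √ν) - lam) ^ 2 / 2))) := ⟨_, rfl⟩
  have hgm : Measurable fun p : ℝ × ℝ => g p.1 p.2 := by
    rw [hg]
    fun_prop
  have hinner : ∀ u : EuclideanSpace ℝ (Fin ν), ‖u‖ = 1 →
      ∫⁻ r in Set.Ioi (0 : ℝ), ENNReal.ofReal (r ^ (ν - 1)) *
        (ENNReal.ofReal ((2 * Real.pi) ^ (-(ν : ℝ) / 2) * Real.exp (-‖r • u‖ ^ 2 / 2)) *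
          ∫⁻ x, f (x / (‖r • u‖ / √ν)) ∂gaussianReal lam 1) =
      ∫⁻ r in Set.Ioi (0 : ℝ), ∫⁻ t, f t * ENNReal.ofReal (g r t) := by
    intro u hu
    refine setLIntegral_congr_fun measurableSet_Ioi fun r hr => ?_
    have hr0 : 0 < r := hr
    have hn : ‖r • u‖ = r := by rw [norm_smul, hu, mul_one, Real.norm_of_nonneg hr0.le]
    beta_reduce
    rw [hn, lintegral_gaussianReal_div lam (div_pos hr0 hsν), ← mul_assoc,
      ← ENNReal.ofReal_mul (pow_nonneg hr0.le _), ← lintegral_const_mul _ (by fun_prop)]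
    refine lintegral_congr fun t => ?_
    rw [mul_left_comm, ← ENNReal.ofReal_mul (by positivity), hg]
  have hrad : ∀ t, sphereMeasure ν Set.univ * ∫⁻ r in Set.Ioi (0 : ℝ), ENNReal.ofReal (g r t) =
      ENNReal.ofReal (noncentralTPDF ν lam t) := by
    rw [hg]
    exact lintegral_radial_eq_noncentralTPDF hν lam
  have hfg : Measurable fun p : ℝ × ℝ => f p.2 * ENNReal.ofReal (g p.1 p.2) := by fun_prop
  have hgt : ∀ t, Measurable fun r => ENNReal.ofReal (g r t) := fun t =>
    ENNReal.measurable_ofReal.comp (hgm.comp (measurable_id.prodMk measurable_const))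
  have hswap : ∫⁻ r in Set.Ioi (0 : ℝ), ∫⁻ t, f t * ENNReal.ofReal (g r t) =
      ∫⁻ t, f t * ∫⁻ r in Set.Ioi (0 : ℝ), ENNReal.ofReal (g r t) := by
    rw [lintegral_lintegral_swap hfg.aemeasurable]
    exact lintegral_congr fun t => lintegral_const_mul _ (hgt t)
  have hI : Measurable fun t => ∫⁻ r in Set.Ioi (0 : ℝ), ENNReal.ofReal (g r t) :=
    Measurable.lintegral_prod_left' (f := fun p : ℝ × ℝ => ENNReal.ofReal (g p.1 p.2))
      (ENNReal.measurable_ofReal.comp hgm)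
  have hfI : Measurable fun t => f t * ∫⁻ r in Set.Ioi (0 : ℝ), ENNReal.ofReal (g r t) :=
    hf.mul hI
  rw [lintegral_noncentralT ν lam hf, stdGaussian_eq_withDensity,
    lintegral_withDensity_eq_lintegral_mul _ (by fun_prop) hHm,
    lintegral_eq_lintegral_sphereMeasure hν ((by fun_prop : Measurable _).mul hHm)]
  simp only [Pi.mul_apply]
  rw [lintegral_congr_ae ((ae_norm_eq_one_sphereMeasure ν).mono hinner), lintegral_const, hswap,
    mul_comm, ← lintegral_const_mul _ hfI,
    lintegral_withDensity_eq_lintegral_mul _ (by fun_prop) hf]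
  refine lintegral_congr fun t => ?_
  rw [mul_left_comm, hrad, mul_comm, Pi.mul_apply]

/-! ### The law of the residual direction for fixed covariates -/

theorem compress_add {k n : ℕ} (A : Matrix (Fin k) (Fin n) ℝ) (y y' : Fin n → ℝ) :
    compress A (y + y') = compress A y + compress A y' := by
  simp [compress, Matrix.mulVec_add]

theorem compress_smul {k n : ℕ} (A : Matrix (Fin k) (Fin n) ℝ) (c : ℝ) (y : Fin n → ℝ) :
    compress A (c • y) = c • compress A y := by
  simp [compress, Matrix.mulVec_smul]

@[fun_prop]
theorem measurable_compress {k n : ℕ} (A : Matrix (Fin k) (Fin n) ℝ) : Measurable (compress A) := by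
  unfold compress
  refine (WithLp.measurable_toLp 2 _).comp (measurable_pi_iff.2 fun i => ?_)
  simp only [Matrix.mulVec, dotProduct]
  fun_prop

@[fun_prop]
theorem measurable_normalizedResidual {k n : ℕ} (A : Matrix (Fin k) (Fin n) ℝ) :
    Measurable (normalizedResidual A) := by
  unfold normalizedResidual
  fun_prop

theorem norm_inv_smul_pos_smul {E : Type*} [NormedAddCommGroup E] [NormedSpace ℝ E] {c : ℝ}
    (hc : 0 < c) (v : E) : ‖c • v‖⁻¹ • c • v = ‖v‖⁻¹ • v := by
  rw [norm_smul, Real.norm_of_nonneg hc.le, mul_inv, smul_smul, mul_right_comm,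
    inv_mul_cancel₀ hc.ne', one_mul]

theorem inner_compress {k n : ℕ} (A : Matrix (Fin k) (Fin n) ℝ) (y : Fin n → ℝ)
    (t : EuclideanSpace ℝ (Fin k)) :
    inner ℝ (compress A y) t = inner ℝ (WithLp.toLp 2 y) (compress Aᵀ t.ofLp) := by
  simp only [compress, EuclideanSpace.inner_eq_star_dotProduct, star_trivial]
  rw [Matrix.dotProduct_mulVec, Matrix.mulVec_transpose]

/-- A matrix with orthonormal rows maps standard Gaussian vectors to standard Gaussian vectors. -/
theorem map_compress_pi_gaussianReal {k n : ℕ} {A : Matrix (Fin k) (Fin n) ℝ} (hA : A * Aᵀ = 1) :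
    (Measure.pi fun _ : Fin n => gaussianReal 0 1).map (compress A) =
      stdGaussian (EuclideanSpace ℝ (Fin k)) := by
  have : IsProbabilityMeasure ((Measure.pi fun _ : Fin n => gaussianReal 0 1).map (compress A)) :=
    Measure.isProbabilityMeasure_map (measurable_compress A).aemeasurable
  refine Measure.ext_of_charFun ?_
  ext t
  have hnorm : ‖compress Aᵀ t.ofLp‖ = ‖t‖ := by
    have h : ‖compress Aᵀ t.ofLp‖ ^ 2 = ‖t‖ ^ 2 := by
      rw [← real_inner_self_eq_norm_sq, ← real_inner_self_eq_norm_sq, inner_compress,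
        Matrix.transpose_transpose, ← real_inner_comm]
      simp only [compress, Matrix.mulVec_mulVec, hA, Matrix.one_mulVec]
    exact (sq_eq_sq₀ (norm_nonneg _) (norm_nonneg _)).1 h
  have h := charFun_stdGaussian (E := EuclideanSpace ℝ (Fin n)) (compress Aᵀ t.ofLp)
  rw [hnorm] at h
  rw [charFun_stdGaussian, ← h, ← map_pi_eq_stdGaussian, charFun_apply, charFun_apply,
    integral_map (by fun_prop) (Measurable.aestronglyMeasurable (by fun_prop)),
    integral_map (by fun_prop) (Measurable.aestronglyMeasurable (by fun_prop))]
  simp only [inner_compress]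

theorem responseLaw_eq_map {n d : ℕ} (δ : ℝ) (β : Fin d → ℝ) (σ : ℝ) (x : Fin n → ℝ)
    (z : Fin n → Fin d → ℝ) :
    responseLaw δ β σ x z = (Measure.pi fun _ : Fin n => gaussianReal 0 1).map
      (fun e i => δ * σ * x i + β ⬝ᵥ z i + σ * e i) := by
  have h := Measure.pi_map_pi (μ := fun _ : Fin n => gaussianReal 0 1)
    (f := fun i (e : ℝ) => δ * σ * x i + β ⬝ᵥ z i + σ * e) (fun i => by fun_prop)
  rw [h, responseLaw]
  congr 1
  ext1 i
  have h1 := gaussianReal_map_const_mul (μ := 0) (v := 1) σ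
  have h2 := gaussianReal_map_const_add (μ := σ * 0) (v := NNReal.mk (σ ^ 2) (sq_nonneg σ) * 1)
    (δ * σ * x i + β ⬝ᵥ z i)
  rw [← h1, Measure.map_map (by fun_prop) (by fun_prop)] at h2
  have h3 : (fun e : ℝ => δ * σ * x i + β ⬝ᵥ z i + σ * e) =
    (fun y => δ * σ * x i + β ⬝ᵥ z i + y) ∘ fun e => σ * e := rfl
  rw [h3, h2, mul_zero, zero_add, mul_one]
  congr 1
  ext
  simp [sq_nonneg]

instance isProbabilityMeasure_responseLaw {n d : ℕ} (δ : ℝ) (β : Fin d → ℝ) (σ : ℝ)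
    (x : Fin n → ℝ) (z : Fin n → Fin d → ℝ) : IsProbabilityMeasure (responseLaw δ β σ x z) := by
  unfold responseLaw
  infer_instance

instance isProbabilityMeasure_residualLaw {n d : ℕ} (A : ResidualBasis d) (δ : ℝ) (β : Fin d → ℝ)
    (σ : ℝ) (x : Fin n → ℝ) (z : Fin n → Fin d → ℝ) :
    IsProbabilityMeasure (residualLaw A δ β σ x z) :=
  Measure.isProbabilityMeasure_map (measurable_normalizedResidual _).aemeasurable

theorem compress_response {d n : ℕ} (A : ResidualBasis d) (δ : ℝ) (β : Fin d → ℝ) (σ : ℝ)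
    (x : Fin n → ℝ) (z : Fin n → Fin d → ℝ) (e : Fin n → ℝ) :
    compress (A.mat n z) (fun i => δ * σ * x i + β ⬝ᵥ z i + σ * e i) =
      σ • (compress (A.mat n z) e + δ • compress (A.mat n z) x) := by
  have h : (fun i => δ * σ * x i + β ⬝ᵥ z i + σ * e i) =
      (σ • (e + δ • x) : Fin n → ℝ) + (Matrix.of z) *ᵥ β := by
    ext i
    simp only [Pi.add_apply, Pi.smul_apply, smul_eq_mul, Matrix.mulVec, Matrix.of_apply]
    rw [dotProduct_comm β]
    change _ = _ + z i ⬝ᵥ β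
    ring
  have h0 : compress (A.mat n z) ((Matrix.of z) *ᵥ β) = 0 := by
    simp [compress, Matrix.mulVec_mulVec, A.mul_design]
  rw [h, compress_add, h0, add_zero, compress_smul, compress_add, compress_smul]

theorem normalizedResidual_response {d n : ℕ} (A : ResidualBasis d) (δ : ℝ) (β : Fin d → ℝ)
    {σ : ℝ} (hσ : 0 < σ) (x : Fin n → ℝ) (z : Fin n → Fin d → ℝ) (e : Fin n → ℝ) :
    normalizedResidual (A.mat n z) (fun i => δ * σ * x i + β ⬝ᵥ z i + σ * e i) =
      ‖compress (A.mat n z) e + δ • compress (A.mat n z) x‖⁻¹ •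
        (compress (A.mat n z) e + δ • compress (A.mat n z) x) := by
  rw [normalizedResidual, compress_response, norm_inv_smul_pos_smul hσ]

/-- The residual direction is the direction of a Gaussian vector with mean `δ A x`: the nuisance
parameters `β` and `σ` are removed by the projection and by the normalization. -/
theorem residualLaw_eq_map {d n : ℕ} (A : ResidualBasis d) (δ : ℝ) (β : Fin d → ℝ) {σ : ℝ}
    (hσ : 0 < σ) (x : Fin n → ℝ) (z : Fin n → Fin d → ℝ) :
    residualLaw A δ β σ x z = (stdGaussian (EuclideanSpace ℝ (Fin (resDim z)))).map fun w =>
      ‖w + δ • compress (A.mat n z) x‖⁻¹ • (w + δ • compress (A.mat n z) x) := by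
  rw [residualLaw, responseLaw_eq_map, ← map_compress_pi_gaussianReal (A.orthonormal n z),
    Measure.map_map (by fun_prop) (by fun_prop), Measure.map_map (by fun_prop) (by fun_prop)]
  congr 1
  ext1 e
  exact normalizedResidual_response A δ β hσ x z e

theorem residualLaw_eq_withDensity {d n : ℕ} (A : ResidualBasis d) (δ : ℝ) (β : Fin d → ℝ) {σ : ℝ}
    (hσ : 0 < σ) (x : Fin n → ℝ) (z : Fin n → Fin d → ℝ) (hk : 1 ≤ resDim z) :
    residualLaw A δ β σ x z = (sphereMeasure (resDim z)).withDensity fun u =>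
      ENNReal.ofReal (directionDensity (δ • compress (A.mat n z) x) u) := by
  rw [residualLaw_eq_map A δ β hσ, map_normalize_stdGaussian hk]

/-! ### Sufficiency of the statistic -/

theorem mem_span_of_projOrth_eq_zero {k : ℕ} {b u : EuclideanSpace ℝ (Fin k)}
    (h : projOrth b u = 0) : u ∈ Submodule.span ℝ {b} := by
  rw [projOrth, sub_eq_zero] at h
  rw [h]
  exact Submodule.smul_mem _ _ (Submodule.mem_span_singleton_self b)

/-- Surface measure does not charge the line through `b`, on which the statistic has the junk value
`0`. -/
theorem ae_projOrth_ne_zero {k : ℕ} (hk : 2 ≤ k) (b : EuclideanSpace ℝ (Fin k)) :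
    ∀ᵐ u ∂sphereMeasure k, projOrth b u ≠ 0 := by
  have hS : Measurable (projOrth b) := by
    unfold projOrth
    fun_prop
  have htop : Submodule.span ℝ {b} ≠ ⊤ := by
    intro h
    have h1 := finrank_span_le_card (R := ℝ) ({b} : Set (EuclideanSpace ℝ (Fin k)))
    rw [h, finrank_top, finrank_euclideanSpace, Fintype.card_fin] at h1
    simp at h1
    omega
  have hms : MeasurableSet {u | projOrth b u ≠ 0} :=
    (measurableSet_eq_fun hS measurable_const).compl
  rw [sphereMeasure, ae_map_iff measurable_subtype_coe.aemeasurable hms, ae_iff]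
  simp only [ne_eq, not_not]
  have hms0 : MeasurableSet
      {a : Metric.sphere (0 : EuclideanSpace ℝ (Fin k)) 1 | projOrth b a = 0} :=
    measurable_subtype_coe (measurableSet_eq_fun hS measurable_const)
  rw [Measure.toSphere_apply' _ hms0]
  refine mul_eq_zero_of_right _ (measure_mono_null ?_ (Measure.addHaar_submodule volume _ htop))
  rintro _ ⟨r, _, _, ⟨u, hu, rfl⟩, rfl⟩
  exact Submodule.smul_mem _ r (mem_span_of_projOrth_eq_zero hu)

theorem norm_projOrth_sq {k : ℕ} {b u : EuclideanSpace ℝ (Fin k)} (hb : b ≠ 0) :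
    ‖projOrth b u‖ ^ 2 = ‖u‖ ^ 2 - (inner ℝ b u / ‖b‖) ^ 2 := by
  have hb' : ‖b‖ ≠ 0 := norm_ne_zero_iff.2 hb
  rw [projOrth, norm_sub_sq_real, norm_smul, mul_pow, real_inner_smul_right, Real.norm_eq_abs,
    sq_abs, real_inner_self_eq_norm_sq, real_inner_comm u b]
  field_simp
  ring

/-- On the sphere the statistic is an increasing function of the inner product with `b`. -/
theorem tStat_div_sqrt {k : ℕ} (hk : 2 ≤ k) {b u : EuclideanSpace ℝ (Fin k)} (hu : ‖u‖ = 1)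
    (hb : b ≠ 0) (hp : projOrth b u ≠ 0) :
    tStat b u / √(tStat b u ^ 2 + ((k - 1 : ℕ) : ℝ)) = inner ℝ b u / ‖b‖ := by
  have hP : 0 < ‖projOrth b u‖ := norm_pos_iff.2 hp
  have hsq := norm_projOrth_sq (u := u) hb
  rw [hu] at hsq
  have hν : ((k - 1 : ℕ) : ℝ) = (k : ℝ) - 1 := by
    rw [Nat.cast_sub (by omega)]
    simp
  have hν0 : 0 < (k : ℝ) - 1 := by
    have : (2 : ℝ) ≤ k := by exact_mod_cast hk
    linarith
  have hs0 := Real.sqrt_pos.2 hν0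
  set s := inner ℝ b u / ‖b‖ with hs
  have ht : tStat b u = s * √((k : ℝ) - 1) / ‖projOrth b u‖ := by
    rw [tStat, ← hs]
    field_simp
  have h2 : tStat b u ^ 2 + ((k : ℝ) - 1) = (√((k : ℝ) - 1) / ‖projOrth b u‖) ^ 2 := by
    rw [ht, div_pow, div_pow, mul_pow, Real.sq_sqrt hν0.le]
    field_simp
    rw [hsq]
    ring
  rw [hν, h2, Real.sqrt_sq (by positivity), ht]
  field_simp

theorem qFactor_mul_noncentralTPDF_tStat {k : ℕ} (hk : 2 ≤ k) (δ : ℝ)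
    {b u : EuclideanSpace ℝ (Fin k)} (hu : ‖u‖ = 1) (hp : projOrth b u ≠ 0) :
    qFactor (k - 1) (tStat b u) * noncentralTPDF (k - 1) (δ * ‖b‖) (tStat b u) =
      directionDensity (δ • b) u := by
  have hk1 : 1 ≤ k - 1 := by omega
  have hcast : ((k - 1 : ℕ) : ℝ) + 1 = k := by
    rw [Nat.cast_sub (by omega)]
    simp
  have harg : δ * ‖b‖ * (tStat b u / √(tStat b u ^ 2 + ((k - 1 : ℕ) : ℝ))) = inner ℝ (δ • b) u := by
    rcases eq_or_ne b 0 with rfl | hb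
    · simp
    · rw [tStat_div_sqrt hk hu hb hp, real_inner_smul_left]
      field_simp [norm_ne_zero_iff.2 hb]
  rw [noncentralTPDF_eq hk1, ← mul_assoc, qFactor_mul_tNormalizer hk1, harg, directionDensity,
    hcast, norm_smul, mul_pow, mul_pow, Real.norm_eq_abs, sq_abs]
  ring

theorem ae_qFactor_mul_noncentralTPDF {k : ℕ} (hk : 2 ≤ k) (δ : ℝ) (b : EuclideanSpace ℝ (Fin k)) :
    ∀ᵐ u ∂sphereMeasure k,
      qFactor (k - 1) (tStat b u) * noncentralTPDF (k - 1) (δ * ‖b‖) (tStat b u) =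
        directionDensity (δ • b) u := by
  filter_upwards [ae_norm_eq_one_sphereMeasure k, ae_projOrth_ne_zero hk b] with u hu hp
  exact qFactor_mul_noncentralTPDF_tStat hk δ hu hp

theorem residualLaw_eq_withDensity_tStat {d n : ℕ} (A : ResidualBasis d) (δ : ℝ) (β : Fin d → ℝ)
    {σ : ℝ} (hσ : 0 < σ) (x : Fin n → ℝ) (z : Fin n → Fin d → ℝ) (hk : 2 ≤ resDim z) :
    residualLaw A δ β σ x z = (sphereMeasure (resDim z)).withDensity fun u =>
      ENNReal.ofReal (qFactor (resDim z - 1) (tStat (compress (A.mat n z) x) u) *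
        noncentralTPDF (resDim z - 1) (δ * ‖compress (A.mat n z) x‖)
          (tStat (compress (A.mat n z) x) u)) := by
  rw [residualLaw_eq_withDensity A δ β hσ x z (by omega)]
  refine withDensity_congr_ae ?_
  filter_upwards [ae_qFactor_mul_noncentralTPDF hk δ (compress (A.mat n z) x)] with u hu
  rw [hu]

/-! ### The law of the statistic -/

theorem projOrth_smul {k : ℕ} (b v : EuclideanSpace ℝ (Fin k)) (c : ℝ) :
    projOrth b (c • v) = c • projOrth b v := by
  rw [projOrth, projOrth, real_inner_smul_right, smul_sub, smul_smul, mul_div_assoc]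

theorem tStat_normalize {k : ℕ} (b v : EuclideanSpace ℝ (Fin k)) :
    tStat b (‖v‖⁻¹ • v) = tStat b v := by
  rcases eq_or_ne v 0 with rfl | hv
  · simp
  · have hc : ‖v‖⁻¹ ≠ 0 := inv_ne_zero (norm_ne_zero_iff.2 hv)
    rw [tStat, tStat, projOrth_smul, real_inner_smul_right, norm_smul, norm_inv, norm_norm,
      mul_div_assoc, mul_left_comm, mul_div_mul_left _ _ hc]

theorem tStat_map {k : ℕ} (L : EuclideanSpace ℝ (Fin k) ≃ₗᵢ[ℝ] EuclideanSpace ℝ (Fin k))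
    (b v : EuclideanSpace ℝ (Fin k)) : tStat (L b) (L v) = tStat b v := by
  simp only [tStat, projOrth, ← map_smul, ← map_sub, LinearIsometryEquiv.norm_map,
    LinearIsometryEquiv.inner_map_map]

@[fun_prop]
theorem measurable_tStat {k : ℕ} (b : EuclideanSpace ℝ (Fin k)) : Measurable (tStat b) := by
  unfold tStat projOrth
  fun_prop

theorem tStat_smul_single {ν : ℕ} {c : ℝ} (hc : 0 < c) (v : EuclideanSpace ℝ (Fin (ν + 1))) :
    tStat (c • EuclideanSpace.single 0 (1 : ℝ)) v =
      v 0 / √((∑ i : Fin ν, v i.succ ^ 2) / ν) := by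
  have hne : c • EuclideanSpace.single (0 : Fin (ν + 1)) (1 : ℝ) ≠ 0 := by
    rw [ne_eq, smul_eq_zero, not_or]
    exact ⟨hc.ne', by simp⟩
  have hn : ‖c • EuclideanSpace.single (0 : Fin (ν + 1)) (1 : ℝ)‖ = c := by
    rw [norm_smul, PiLp.norm_single, norm_one, mul_one, Real.norm_of_nonneg hc.le]
  have hi : inner ℝ (c • EuclideanSpace.single (0 : Fin (ν + 1)) (1 : ℝ)) v / c = v 0 := by
    rw [real_inner_smul_left, EuclideanSpace.inner_single_left]
    simp [hc.ne']
  have hP := norm_projOrth_sq (u := v) hne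
  rw [hn, hi, EuclideanSpace.real_norm_sq_eq v, Fin.sum_univ_succ, add_sub_cancel_left] at hP
  rw [tStat, hn, hi, ← Real.sqrt_sq (norm_nonneg (projOrth _ v)), hP,
    Real.sqrt_div (Finset.sum_nonneg fun i _ => sq_nonneg _)]
  simp only [Nat.cast_add, Nat.cast_one, add_sub_cancel_right]
  rw [one_div, inv_mul_eq_div]

/-- A reflection taking `b` to the first axis reduces the statistic of a Gaussian vector to the
quotient defining the noncentral `t` distribution. -/
theorem map_tStat_stdGaussian {ν : ℕ} {b : EuclideanSpace ℝ (Fin (ν + 1))} (hb : b ≠ 0) (δ : ℝ) :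
    (stdGaussian (EuclideanSpace ℝ (Fin (ν + 1)))).map (fun w => tStat b (w + δ • b)) =
      noncentralT ν (δ * ‖b‖) := by
  have hb' : 0 < ‖b‖ := norm_pos_iff.2 hb
  set c : EuclideanSpace ℝ (Fin (ν + 1)) := ‖b‖ • EuclideanSpace.single 0 (1 : ℝ) with hc
  have hcn : ‖b‖ = ‖c‖ := by
    rw [hc, norm_smul, PiLp.norm_single, norm_one, mul_one, norm_norm]
  set L := (Submodule.span ℝ {b - c})ᗮ.reflection with hL
  have hLb : L b = c := Submodule.reflection_sub hcn
  have h1 : ∀ w, tStat b (w + δ • b) = tStat c (L w + δ • c) := by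
    intro w
    rw [← hLb, ← map_smul, ← map_add, tStat_map]
  have h2 : (stdGaussian (EuclideanSpace ℝ (Fin (ν + 1)))).map (fun w => tStat b (w + δ • b)) =
      (stdGaussian (EuclideanSpace ℝ (Fin (ν + 1)))).map (fun w => tStat c (w + δ • c)) := by
    conv_rhs => rw [← stdGaussian_map L, Measure.map_map (by fun_prop) (by fun_prop)]
    exact congrArg₂ _ (funext h1) rfl
  have h3 : noncentralT ν (δ * ‖b‖) =
      ((gaussianReal 0 1).prod (Measure.pi fun _ : Fin ν => gaussianReal 0 1)).map
        (fun p => (p.1 + δ * ‖b‖) / √((∑ i, p.2 i ^ 2) / ν)) := by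
    have hmap := Measure.map_prod_map (gaussianReal 0 1)
      (Measure.pi fun _ : Fin ν => gaussianReal 0 1)
      (measurable_add_const (δ * ‖b‖)) measurable_id
    rw [gaussianReal_map_add_const, zero_add, Measure.map_id] at hmap
    rw [noncentralT, hmap, Measure.map_map (by fun_prop) (by fun_prop)]
    rfl
  have hmp := measurePreserving_piFinSuccAbove (fun _ : Fin (ν + 1) => gaussianReal 0 1) 0
  rw [h2, h3, ← map_pi_eq_stdGaussian, Measure.map_map (by fun_prop) (by fun_prop), ← hmp.map_eq,
    Measure.map_map (by fun_prop) (MeasurableEquiv.measurable _)]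
  congr 1
  ext1 e
  simp only [Function.comp_apply, hc, tStat_smul_single hb']
  simp [MeasurableEquiv.piFinSuccAbove, Fin.insertNthEquiv, Fin.tail]

theorem map_tStat_residualLaw {d n : ℕ} (A : ResidualBasis d) (δ : ℝ) (β : Fin d → ℝ) {σ : ℝ}
    (hσ : 0 < σ) (x : Fin n → ℝ) (z : Fin n → Fin d → ℝ) (hk : 2 ≤ resDim z)
    (hb : compress (A.mat n z) x ≠ 0) :
    (residualLaw A δ β σ x z).map (tStat (compress (A.mat n z) x)) =
      noncentralT (resDim z - 1) (δ * ‖compress (A.mat n z) x‖) := by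
  rw [residualLaw_eq_map A δ β hσ, Measure.map_map (by fun_prop) (by fun_prop)]
  have h : ∀ {k : ℕ} {b : EuclideanSpace ℝ (Fin k)}, 2 ≤ k → b ≠ 0 →
      (stdGaussian (EuclideanSpace ℝ (Fin k))).map
        (tStat b ∘ fun w => ‖w + δ • b‖⁻¹ • (w + δ • b)) = noncentralT (k - 1) (δ * ‖b‖) := by
    intro k b hk hb
    obtain ⟨ν, rfl⟩ : ∃ ν, k = ν + 1 := ⟨k - 1, by omega⟩
    rw [Nat.add_sub_cancel, ← map_tStat_stdGaussian hb]
    exact congrArg₂ _ (funext fun w => tStat_normalize b _) rfl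
  exact h hk hb

/-! ### The likelihood ratio for fixed covariates -/

theorem finite_norm_eq_one {k : ℕ} (hk : k ≤ 1) :
    {u : EuclideanSpace ℝ (Fin k) | ‖u‖ = 1}.Finite := by
  have hs : Subsingleton (Fin k) := Fin.subsingleton_iff_le_one.2 hk
  refine Set.Finite.of_finite_image (f := WithLp.ofLp)
    ((Set.Finite.pi' (t := fun _ : Fin k => ({1, -1} : Set ℝ)) fun _ => by simp).subset ?_)
    (WithLp.ofLp_injective 2).injOn
  rintro _ ⟨u, hu, rfl⟩ i
  have h : ‖u‖ ^ 2 = u i ^ 2 := by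
    rw [EuclideanSpace.real_norm_sq_eq]
    exact Fintype.sum_subsingleton _ i
  rw [Set.mem_ofPred_eq] at hu
  rw [hu, one_pow] at h
  exact sq_eq_one_iff.1 h.symm

/-- For `k ≤ 1` the sphere is finite, so almost every point is an atom. -/
theorem ae_sphereMeasure_singleton_ne_zero {k : ℕ} (hk : k ≤ 1) :
    ∀ᵐ u ∂sphereMeasure k, sphereMeasure k {u} ≠ 0 := by
  have h : sphereMeasure k (⋃ u ∈ {u : EuclideanSpace ℝ (Fin k) | ‖u‖ = 1 ∧
      sphereMeasure k {u} = 0}, {u}) = 0 :=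
    (measure_biUnion_null_iff (((finite_norm_eq_one hk).subset fun u hu => hu.1).countable)).2
      fun u hu => hu.2
  have h' := measure_eq_zero_iff_ae_notMem.1 h
  filter_upwards [h', ae_norm_eq_one_sphereMeasure k] with u hu h1 h0
  exact hu (Set.mem_biUnion (x := u) ⟨h1, h0⟩ rfl)

/-- On the sphere, the likelihood ratio is the ratio of the densities of the direction of the
residual relative to surface measure. For `k = 1` this holds because almost every point
is an atom. -/
theorem ae_likelihoodRatio_eq {d n : ℕ} (A : ResidualBasis d) (δ₀ δp : ℝ) (x : Fin n → ℝ)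
    (z : Fin n → Fin d → ℝ) (hk : 1 ≤ resDim z) :
    ∀ᵐ u ∂sphereMeasure (resDim z), likelihoodRatio A δ₀ δp x z u =
      directionDensity (δp • compress (A.mat n z) x) u /
        directionDensity (δ₀ • compress (A.mat n z) x) u := by
  by_cases h2 : 2 ≤ resDim z
  · filter_upwards [ae_qFactor_mul_noncentralTPDF h2 δp (compress (A.mat n z) x),
      ae_qFactor_mul_noncentralTPDF h2 δ₀ (compress (A.mat n z) x)] with u hp h0
    have hq : qFactor (resDim z - 1) (tStat (compress (A.mat n z) x) u) ≠ 0 := by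
      intro h
      rw [h, zero_mul] at hp
      exact (directionDensity_pos _ _).ne hp
    rw [likelihoodRatio, if_pos h2, ← hp, ← h0, mul_div_mul_left _ _ hq]
  · filter_upwards [ae_sphereMeasure_singleton_ne_zero (k := resDim z) (by omega)] with u hu
    have hm : ∀ δ, (residualLaw A δ 0 1 x z).real {u} =
        directionDensity (δ • compress (A.mat n z) x) u * (sphereMeasure (resDim z)).real {u} := by
      intro δ
      rw [residualLaw_eq_withDensity A δ 0 one_pos x z hk, measureReal_def,
        withDensity_apply _ (measurableSet_singleton u), lintegral_singleton, ENNReal.toReal_mul,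
        ENNReal.toReal_ofReal (directionDensity_pos _ _).le, measureReal_def]
    have hs : (sphereMeasure (resDim z)).real {u} ≠ 0 :=
      ENNReal.toReal_ne_zero.2 ⟨hu, measure_ne_top _ _⟩
    rw [likelihoodRatio, if_neg h2, hm, hm, mul_div_mul_right _ _ hs]

theorem residualLaw_eq_dirac {d n : ℕ} (A : ResidualBasis d) (δ : ℝ) (β : Fin d → ℝ) (σ : ℝ)
    (x : Fin n → ℝ) (z : Fin n → Fin d → ℝ) (hk : resDim z = 0) :
    residualLaw A δ β σ x z = Measure.dirac 0 := by
  have : IsEmpty (Fin (resDim z)) := by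
    rw [hk]
    infer_instance
  have hs : Subsingleton (EuclideanSpace ℝ (Fin (resDim z))) :=
    (WithLp.ofLp_injective 2).subsingleton
  ext s _
  rcases s.eq_empty_or_nonempty with rfl | hne
  · simp
  · rw [Subsingleton.eq_univ_of_nonempty hne, measure_univ, measure_univ]

theorem likelihoodRatio_eq_one {d n : ℕ} (A : ResidualBasis d) (δ₀ δp : ℝ) (x : Fin n → ℝ)
    (z : Fin n → Fin d → ℝ) (hk : resDim z = 0) (u : EuclideanSpace ℝ (Fin (resDim z))) :
    likelihoodRatio A δ₀ δp x z u = 1 := by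
  have : IsEmpty (Fin (resDim z)) := by
    rw [hk]
    infer_instance
  have hs : Subsingleton (EuclideanSpace ℝ (Fin (resDim z))) :=
    (WithLp.ofLp_injective 2).subsingleton
  rw [likelihoodRatio, if_neg (by omega), residualLaw_eq_dirac A _ _ _ _ _ hk,
    residualLaw_eq_dirac A _ _ _ _ _ hk, Subsingleton.elim u 0]
  simp [measureReal_def]

theorem likelihoodRatio_nonneg {d n : ℕ} (A : ResidualBasis d) (δ₀ δp : ℝ) (x : Fin n → ℝ)
    (z : Fin n → Fin d → ℝ) (u : EuclideanSpace ℝ (Fin (resDim z))) :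
    0 ≤ likelihoodRatio A δ₀ δp x z u := by
  rw [likelihoodRatio]
  split_ifs with h
  · exact div_nonneg (noncentralTPDF_pos (by omega) _ _).le (noncentralTPDF_pos (by omega) _ _).le
  · positivity

theorem residualLaw_absolutelyContinuous {d n : ℕ} (A : ResidualBasis d) (δ : ℝ) (β : Fin d → ℝ)
    {σ : ℝ} (hσ : 0 < σ) (x : Fin n → ℝ) (z : Fin n → Fin d → ℝ) (hk : 1 ≤ resDim z) :
    residualLaw A δ β σ x z ≪ sphereMeasure (resDim z) := by
  rw [residualLaw_eq_withDensity A δ β hσ x z hk]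
  exact withDensity_absolutelyContinuous _ _

theorem residualLaw_eq_withDensity_div {d n : ℕ} (A : ResidualBasis d) (δ₀ δp : ℝ)
    (β₀ βp : Fin d → ℝ) {σ₀ σp : ℝ} (hσ₀ : 0 < σ₀) (hσp : 0 < σp) (x : Fin n → ℝ)
    (z : Fin n → Fin d → ℝ) (hk : 1 ≤ resDim z) :
    residualLaw A δp βp σp x z = (residualLaw A δ₀ β₀ σ₀ x z).withDensity fun u =>
      ENNReal.ofReal (directionDensity (δp • compress (A.mat n z) x) u /
        directionDensity (δ₀ • compress (A.mat n z) x) u) := by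
  rw [residualLaw_eq_withDensity A δ₀ β₀ hσ₀ x z hk, residualLaw_eq_withDensity A δp βp hσp x z hk,
    ← withDensity_mul _ (by fun_prop) (by fun_prop)]
  congr 1
  ext1 u
  have h0 := directionDensity_pos (δ₀ • compress (A.mat n z) x) u
  rw [Pi.mul_apply, ← ENNReal.ofReal_mul h0.le, mul_div_cancel₀ _ h0.ne']

theorem residualLaw_eq_withDensity_likelihoodRatio {d n : ℕ} (A : ResidualBasis d) (δ₀ δp : ℝ)
    (β₀ βp : Fin d → ℝ) {σ₀ σp : ℝ} (hσ₀ : 0 < σ₀) (hσp : 0 < σp) (x : Fin n → ℝ)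
    (z : Fin n → Fin d → ℝ) :
    residualLaw A δp βp σp x z = (residualLaw A δ₀ β₀ σ₀ x z).withDensity fun u =>
      ENNReal.ofReal (likelihoodRatio A δ₀ δp x z u) := by
  rcases Nat.eq_zero_or_pos (resDim z) with hk | hk
  · simp only [likelihoodRatio_eq_one A δ₀ δp x z hk, ENNReal.ofReal_one]
    rw [residualLaw_eq_dirac A _ _ _ _ _ hk, residualLaw_eq_dirac A _ _ _ _ _ hk]
    exact withDensity_one.symm
  · rw [residualLaw_eq_withDensity_div A δ₀ δp β₀ βp hσ₀ hσp x z hk]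
    refine withDensity_congr_ae ?_
    filter_upwards [(residualLaw_absolutelyContinuous A δ₀ β₀ hσ₀ x z hk).ae_le
      (ae_likelihoodRatio_eq A δ₀ δp x z hk)] with u hu
    rw [hu]

/-! ### Measurability in disjoint unions -/

/-- A function of two points of countable disjoint unions is measurable if it is measurable for
each choice of the two indices. -/
theorem measurable_of_measurable_sigma_mk_prod {ι κ γ τ : Type*} [Countable ι] [Countable κ]
    {α : ι → Type*} {β : κ → Type*} [∀ i, MeasurableSpace (α i)] [∀ i, MeasurableSpace (β i)]
    [MeasurableSpace γ] [MeasurableSpace τ] {f : (Σ i, α i) × (Σ j, β j) × τ → γ}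
    (h : ∀ i j, Measurable fun p : α i × β j × τ => f (⟨i, p.1⟩, ⟨j, p.2.1⟩, p.2.2)) :
    Measurable f := by
  intro s hs
  have : f ⁻¹' s = ⋃ (i : ι) (j : κ), Prod.map (Sigma.mk i) (Prod.map (Sigma.mk j) id) ''
      ((fun p : α i × β j × τ => f (⟨i, p.1⟩, ⟨j, p.2.1⟩, p.2.2)) ⁻¹' s) := by
    ext ⟨⟨i, a⟩, ⟨j, b⟩, t⟩
    simp only [Set.mem_iUnion, Set.mem_image, Set.mem_preimage]
    constructor
    · intro hf
      exact ⟨i, j, (a, b, t), hf, rfl⟩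
    · rintro ⟨i', j', p, hp, he⟩
      rw [← he]
      exact hp
  rw [this]
  refine MeasurableSet.iUnion fun i => MeasurableSet.iUnion fun j => ?_
  exact ((measurableEmbedding_sigma_mk i).prodMap
    ((measurableEmbedding_sigma_mk j).prodMap MeasurableEmbedding.id)).measurableSet_image.2
      (h i j hs)

@[fun_prop]
theorem measurable_compress_uncurry {γ : Type*} [MeasurableSpace γ] {k n : ℕ}
    {M : γ → Fin k → Fin n → ℝ} {y : γ → Fin n → ℝ} (hM : Measurable M) (hy : Measurable y) :
    Measurable fun p => compress (Matrix.of (M p)) (y p) := by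
  unfold compress
  refine (WithLp.measurable_toLp 2 _).comp (measurable_pi_iff.2 fun i => ?_)
  simp only [Matrix.mulVec, dotProduct, Matrix.of_apply]
  fun_prop

/-- The coordinates of the arguments, padded with zeros, form sequences of random variables, to
which `measurable_residualSigma` applies. -/
theorem measurable_sigma_normalizedResidual {d : ℕ} (A : ResidualBasis d) (n : ℕ) :
    Measurable fun p : (Fin n → Fin d → ℝ) × (Fin n → ℝ) =>
      (⟨resDim p.1, normalizedResidual (A.mat n p.1) p.2⟩ : Σ k : ℕ, EuclideanSpace ℝ (Fin k)) := by
  have hY : ∀ i : ℕ, Measurable fun p : (Fin n → Fin d → ℝ) × (Fin n → ℝ) =>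
      if h : i < n then p.2 ⟨i, h⟩ else 0 := by
    intro i
    split_ifs <;> fun_prop
  have hZ : ∀ i : ℕ, Measurable fun p : (Fin n → Fin d → ℝ) × (Fin n → ℝ) =>
      if h : i < n then p.1 ⟨i, h⟩ else 0 := by
    intro i
    split_ifs <;> fun_prop
  have h := measurable_residualSigma A hY hZ n
  have hz : ∀ p : (Fin n → Fin d → ℝ) × (Fin n → ℝ),
      firstN (fun (i : ℕ) (p : (Fin n → Fin d → ℝ) × (Fin n → ℝ)) =>
        if h : i < n then p.1 ⟨i, h⟩ else 0) n p = p.1 := fun p => by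
    ext i
    simp [firstN]
  have hy : ∀ p : (Fin n → Fin d → ℝ) × (Fin n → ℝ),
      firstN (fun (i : ℕ) (p : (Fin n → Fin d → ℝ) × (Fin n → ℝ)) =>
        if h : i < n then p.2 ⟨i, h⟩ else 0) n p = p.2 := fun p => by
    ext i
    simp [firstN]
  have key : ∀ (p : (Fin n → Fin d → ℝ) × (Fin n → ℝ)) z' y', z' = p.1 → y' = p.2 →
      (⟨resDim p.1, normalizedResidual (A.mat n p.1) p.2⟩ : Σ k : ℕ, EuclideanSpace ℝ (Fin k)) =
        ⟨resDim z', normalizedResidual (A.mat n z') y'⟩ := by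
    rintro p _ _ rfl rfl
    rfl
  convert! h using 2 with p
  exact key p _ _ (hz p) (hy p)

/-! ### The likelihood ratio as a function of the coarsened observation -/

/-- The probability that the residual direction equals `u`, as a function of the residual matrix. -/
def directionMass (δ : ℝ) {k n : ℕ} (M : Fin k → Fin n → ℝ) (x : Fin n → ℝ)
    (u : EuclideanSpace ℝ (Fin k)) : ℝ :=
  (Measure.pi fun _ : Fin n => gaussianReal 0 1).real
    {e | ‖compress (Matrix.of M) e + δ • compress (Matrix.of M) x‖⁻¹ •
      (compress (Matrix.of M) e + δ • compress (Matrix.of M) x) = u}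

theorem measurable_directionMass (δ : ℝ) (k n : ℕ) :
    Measurable fun p : (Fin k → Fin n → ℝ) × EuclideanSpace ℝ (Fin k) × (Fin n → ℝ) =>
      directionMass δ p.1 p.2.2 p.2.1 := by
  have hs : MeasurableSet {q : ((Fin k → Fin n → ℝ) × EuclideanSpace ℝ (Fin k) × (Fin n → ℝ)) ×
      (Fin n → ℝ) | ‖compress (Matrix.of q.1.1) q.2 + δ • compress (Matrix.of q.1.1) q.1.2.2‖⁻¹ •
        (compress (Matrix.of q.1.1) q.2 + δ • compress (Matrix.of q.1.1) q.1.2.2) = q.1.2.1} :=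
    measurableSet_eq_fun (by fun_prop) (by fun_prop)
  exact (measurable_measure_prodMk_left (ν := Measure.pi fun _ : Fin n => gaussianReal 0 1)
    hs).ennreal_toReal

/-- The likelihood ratio as a function of the residual matrix rather than of the design. -/
def likelihoodRatioOfMatrix (δ₀ δp : ℝ) {k n : ℕ} (M : Fin k → Fin n → ℝ) (x : Fin n → ℝ)
    (u : EuclideanSpace ℝ (Fin k)) : ℝ :=
  if 2 ≤ k then
    noncentralTPDF (k - 1) (δp * ‖compress (Matrix.of M) x‖)
        (tStat (compress (Matrix.of M) x) u) /
      noncentralTPDF (k - 1) (δ₀ * ‖compress (Matrix.of M) x‖)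
        (tStat (compress (Matrix.of M) x) u)
  else directionMass δp M x u / directionMass δ₀ M x u

theorem likelihoodRatio_eq_ofMatrix {d n : ℕ} (A : ResidualBasis d) (δ₀ δp : ℝ) (x : Fin n → ℝ)
    (z : Fin n → Fin d → ℝ) (u : EuclideanSpace ℝ (Fin (resDim z))) :
    likelihoodRatio A δ₀ δp x z u = likelihoodRatioOfMatrix δ₀ δp (A.mat n z) x u := by
  have hm : ∀ δ, (residualLaw A δ 0 1 x z).real {u} = directionMass δ (A.mat n z) x u := by
    intro δ
    rw [residualLaw_eq_map A δ 0 one_pos, ← map_compress_pi_gaussianReal (A.orthonormal n z),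
      Measure.map_map (by fun_prop) (by fun_prop), measureReal_def,
      Measure.map_apply (by fun_prop) (measurableSet_singleton u)]
    rfl
  rw [likelihoodRatio, hm, hm]
  rfl

theorem measurable_likelihoodRatioOfMatrix (δ₀ δp : ℝ) (k n : ℕ) :
    Measurable fun p : (Fin k → Fin n → ℝ) × EuclideanSpace ℝ (Fin k) × (Fin n → ℝ) =>
      likelihoodRatioOfMatrix δ₀ δp p.1 p.2.2 p.2.1 := by
  by_cases hk : 2 ≤ k
  · have hν : 1 ≤ k - 1 := by omega
    simp only [likelihoodRatioOfMatrix, if_pos hk, noncentralTPDF_eq hν, tNormalizer, tStat,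
      projOrth]
    fun_prop
  · simp only [likelihoodRatioOfMatrix, if_neg hk]
    exact (measurable_directionMass δp k n).div (measurable_directionMass δ₀ k n)

/-- The likelihood ratio on the space of coarsened observations; it is set to `0` at observations
whose residual does not have the dimension prescribed by the design. -/
def likelihoodRatioObs {d : ℕ} (A : ResidualBasis d) (δ₀ δp : ℝ) (n : ℕ)
    (m : (Σ k : ℕ, EuclideanSpace ℝ (Fin k)) × ((Fin n → ℝ) × (Fin n → Fin d → ℝ))) : ℝ :=
  if h : m.1.1 = resDim m.2.2 then likelihoodRatio A δ₀ δp m.2.1 m.2.2 (h ▸ m.1.2) else 0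

@[simp]
theorem likelihoodRatioObs_mk {d n : ℕ} (A : ResidualBasis d) (δ₀ δp : ℝ) (x : Fin n → ℝ)
    (z : Fin n → Fin d → ℝ) (u : EuclideanSpace ℝ (Fin (resDim z))) :
    likelihoodRatioObs A δ₀ δp n (⟨resDim z, u⟩, x, z) = likelihoodRatio A δ₀ δp x z u := by
  simp [likelihoodRatioObs]

theorem measurable_likelihoodRatioObs {d : ℕ} (A : ResidualBasis d) (δ₀ δp : ℝ) (n : ℕ) :
    Measurable (likelihoodRatioObs A δ₀ δp n) := by
  let f : (Σ k : ℕ, Fin k → Fin n → ℝ) × (Σ k : ℕ, EuclideanSpace ℝ (Fin k)) × (Fin n → ℝ) → ℝ :=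
    fun p => if h : p.2.1.1 = p.1.1 then
      likelihoodRatioOfMatrix δ₀ δp p.1.2 p.2.2 (h ▸ p.2.1.2) else 0
  have hf : Measurable f := by
    refine measurable_of_measurable_sigma_mk_prod fun i j => ?_
    by_cases h : j = i
    · subst h
      simpa [f] using measurable_likelihoodRatioOfMatrix δ₀ δp j n
    · simp [f, h]
  have hg : Measurable fun m : (Σ k : ℕ, EuclideanSpace ℝ (Fin k)) ×
      ((Fin n → ℝ) × (Fin n → Fin d → ℝ)) =>
      ((⟨resDim m.2.2, fun i j => A.mat n m.2.2 i j⟩ : Σ k : ℕ, Fin k → Fin n → ℝ), m.1, m.2.1) :=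
    ((A.measurable n).comp measurable_snd.snd).prodMk (measurable_fst.prodMk measurable_snd.fst)
  convert! hf.comp hg using 1
  ext m
  simp only [likelihoodRatioObs, f, Function.comp_apply]
  split_ifs
  · exact likelihoodRatio_eq_ofMatrix A δ₀ δp _ _ _
  · rfl

theorem measurable_likelihoodRatio {d n : ℕ} (A : ResidualBasis d) (δ₀ δp : ℝ) (x : Fin n → ℝ)
    (z : Fin n → Fin d → ℝ) : Measurable (likelihoodRatio A δ₀ δp x z) := by
  have h := (measurable_likelihoodRatioObs A δ₀ δp n).comp
    ((measurableEmbedding_sigma_mk (α := fun k => EuclideanSpace ℝ (Fin k))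
      (resDim z)).measurable.prodMk (measurable_const (a := (x, z))))
  convert! h using 1
  ext u
  exact (likelihoodRatioObs_mk A δ₀ δp x z u).symm

/-! ### Restriction to fewer observations -/

/-- The rows of the residual matrix span the orthogonal complement of the design. -/
theorem transpose_mulVec_mulVec_of_vecMul_eq_zero {d n : ℕ} (A : ResidualBasis d)
    (z : Fin n → Fin d → ℝ) {v : Fin n → ℝ} (hv : (Matrix.of z)ᵀ *ᵥ v = 0) :
    (A.mat n z)ᵀ *ᵥ (A.mat n z *ᵥ v) = v := by
  have hinj : Function.Injective (A.mat n z)ᵀ.mulVecLin := by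
    intro a b hab
    have := congrArg (A.mat n z *ᵥ ·) hab
    simpa only [Matrix.mulVecLin_apply, Matrix.mulVec_mulVec, A.orthonormal,
      Matrix.one_mulVec] using this
  have hle : LinearMap.range (A.mat n z)ᵀ.mulVecLin ≤ LinearMap.ker (Matrix.of z)ᵀ.mulVecLin := by
    rintro _ ⟨w, rfl⟩
    rw [LinearMap.mem_ker, Matrix.mulVecLin_apply, Matrix.mulVecLin_apply, Matrix.mulVec_mulVec,
      ← Matrix.transpose_mul, A.mul_design]
    simp
  have hfin : Module.finrank ℝ (LinearMap.range (A.mat n z)ᵀ.mulVecLin) =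
      Module.finrank ℝ (LinearMap.ker (Matrix.of z)ᵀ.mulVecLin) := by
    have h1 := LinearMap.finrank_range_add_finrank_ker (Matrix.of z)ᵀ.mulVecLin
    have h2 : Module.finrank ℝ (LinearMap.range (Matrix.of z)ᵀ.mulVecLin) =
      (Matrix.of z).rank := Matrix.rank_transpose _
    rw [LinearMap.finrank_range_of_inj hinj]
    simp only [Module.finrank_fin_fun] at h1 ⊢
    omega
  have heq := Submodule.eq_of_le_of_finrank_eq hle hfin
  have hmem : v ∈ LinearMap.range (A.mat n z)ᵀ.mulVecLin := by
    rw [heq]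
    exact hv
  obtain ⟨w, rfl⟩ := hmem
  rw [Matrix.mulVecLin_apply, Matrix.mulVec_mulVec w (A.mat n z), A.orthonormal,
    Matrix.one_mulVec]

/-- The residual of the first `m` observations is a function of the residual of all of them: a
vector orthogonal to the first rows of the design stays so when padded with zeros. -/
theorem compress_comp_castLE {d m n : ℕ} (A : ResidualBasis d) (h : m ≤ n)
    (z : Fin n → Fin d → ℝ) (y : Fin n → ℝ) :
    compress (A.mat m (z ∘ Fin.castLE h))
        (((A.mat n z)ᵀ *ᵥ (A.mat n z *ᵥ y)) ∘ Fin.castLE h) =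
      compress (A.mat m (z ∘ Fin.castLE h)) (y ∘ Fin.castLE h) := by
  set M := A.mat n z
  set M' := A.mat m (z ∘ Fin.castLE h) with hM'
  have hsum : ∀ (a : Fin m → ℝ) (v : Fin n → ℝ),
      ∑ j, a j * v (Fin.castLE h j) = ∑ j, Function.extend (Fin.castLE h) a 0 j * v j := by
    intro a v
    refine Fintype.sum_of_injective (Fin.castLE h) (Fin.castLE_injective h) _ _ ?_ ?_
    · intro j hj
      rw [Function.extend_apply' _ _ _ hj]
      simp
    · intro j
      rw [(Fin.castLE_injective h).extend_apply]
  refine congrArg (WithLp.toLp 2) (funext fun i => ?_)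
  set a : Fin n → ℝ := Function.extend (Fin.castLE h) (M' i) 0 with ha
  have horth : (Matrix.of z)ᵀ *ᵥ a = 0 := by
    ext l
    have h0 := congrFun (congrFun (A.mul_design m (z ∘ Fin.castLE h)) i) l
    rw [Matrix.mul_apply, ← hM'] at h0
    simp only [Matrix.of_apply, Function.comp_apply, Matrix.zero_apply] at h0
    rw [hsum (M' i) (fun j => z j l)] at h0
    simp only [Matrix.mulVec, dotProduct, Matrix.transpose_apply, Matrix.of_apply, Pi.zero_apply]
    rw [← h0]
    exact Finset.sum_congr rfl fun j _ => mul_comm _ _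
  have hproj := transpose_mulVec_mulVec_of_vecMul_eq_zero A z horth
  have e1 : ∀ v : Fin n → ℝ, (M' *ᵥ (v ∘ Fin.castLE h)) i = a ⬝ᵥ v := fun v => hsum (M' i) v
  rw [e1, e1]
  calc a ⬝ᵥ Mᵀ *ᵥ (M *ᵥ y) = (M *ᵥ a) ⬝ᵥ (M *ᵥ y) := by
        rw [Matrix.dotProduct_mulVec, Matrix.vecMul_transpose]
    _ = (Mᵀ *ᵥ (M *ᵥ a)) ⬝ᵥ y := by
        rw [Matrix.dotProduct_mulVec, Matrix.mulVec_transpose]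
    _ = a ⬝ᵥ y := by rw [hproj]

/-- The normalized residual of the first `m` observations as a function of the normalized residual
of `n ≥ m` observations. -/
def restrictResidual {d m n : ℕ} (A : ResidualBasis d) (h : m ≤ n) (z : Fin n → Fin d → ℝ)
    (u : EuclideanSpace ℝ (Fin (resDim z))) :
    EuclideanSpace ℝ (Fin (resDim (z ∘ Fin.castLE h))) :=
  normalizedResidual (A.mat m (z ∘ Fin.castLE h)) (((A.mat n z)ᵀ *ᵥ u.ofLp) ∘ Fin.castLE h)

/-- If the residual of all observations vanishes, so does that of the first `m`, and both sides are
`0`. -/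
theorem restrictResidual_normalizedResidual {d m n : ℕ} (A : ResidualBasis d) (h : m ≤ n)
    (z : Fin n → Fin d → ℝ) (y : Fin n → ℝ) :
    restrictResidual A h z (normalizedResidual (A.mat n z) y) =
      normalizedResidual (A.mat m (z ∘ Fin.castLE h)) (y ∘ Fin.castLE h) := by
  have h1 : ∀ c : ℝ, compress (A.mat m (z ∘ Fin.castLE h))
      (((A.mat n z)ᵀ *ᵥ (c • compress (A.mat n z) y).ofLp) ∘ Fin.castLE h) =
      c • compress (A.mat m (z ∘ Fin.castLE h)) (y ∘ Fin.castLE h) := by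
    intro c
    rw [← compress_comp_castLE A h z y, ← compress_smul (A.mat m (z ∘ Fin.castLE h)) c]
    congr 1
    rw [WithLp.ofLp_smul, Matrix.mulVec_smul]
    rfl
  rw [restrictResidual, normalizedResidual, normalizedResidual, normalizedResidual, h1]
  rcases eq_or_ne (compress (A.mat n z) y) 0 with h0 | h0
  · have : compress (A.mat m (z ∘ Fin.castLE h)) (y ∘ Fin.castLE h) = 0 := by
      have h2 := h1 1
      rw [h0, one_smul, one_smul] at h2
      rw [← h2]
      simp [compress]
    simp [this]
  · exact norm_inv_smul_pos_smul (inv_pos.2 (norm_pos_iff.2 h0)) _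

theorem measurable_restrictResidual {d m n : ℕ} (A : ResidualBasis d) (h : m ≤ n)
    (z : Fin n → Fin d → ℝ) : Measurable (restrictResidual A h z) := by
  refine (measurable_normalizedResidual _).comp (measurable_pi_iff.2 fun i => ?_)
  simp only [Function.comp_apply, Matrix.mulVec, dotProduct]
  fun_prop

theorem map_restrict_pi {m n : ℕ} (h : m ≤ n) (μ : Fin n → Measure ℝ)
    [∀ i, IsProbabilityMeasure (μ i)] :
    (Measure.pi μ).map (fun y => y ∘ Fin.castLE h) = Measure.pi fun i => μ (Fin.castLE h i) := by
  symm
  refine Measure.pi_eq fun s hs => ?_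
  have hm : Measurable fun y : Fin n → ℝ => y ∘ Fin.castLE h := by
    refine measurable_pi_iff.2 fun i => ?_
    simp only [Function.comp_apply]
    fun_prop
  rw [Measure.map_apply hm (MeasurableSet.univ_pi hs)]
  have hpre : (fun y : Fin n → ℝ => y ∘ Fin.castLE h) ⁻¹' Set.univ.pi s =
      Set.univ.pi (Function.extend (Fin.castLE h) s fun _ => Set.univ) := by
    ext y
    simp only [Set.mem_preimage, Set.mem_univ_pi, Function.comp_apply]
    constructor
    · intro hy i
      by_cases hi : ∃ j, Fin.castLE h j = i
      · obtain ⟨j, rfl⟩ := hi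
        rw [(Fin.castLE_injective h).extend_apply]
        exact hy j
      · rw [Function.extend_apply' _ _ _ hi]
        trivial
    · intro hy i
      have := hy (Fin.castLE h i)
      rwa [(Fin.castLE_injective h).extend_apply] at this
  rw [hpre, Measure.pi_pi]
  symm
  refine Fintype.prod_of_injective (Fin.castLE h) (Fin.castLE_injective h) _ _ ?_ ?_
  · intro j hj
    rw [Function.extend_apply' _ _ _ hj]
    exact measure_univ
  · intro j
    rw [(Fin.castLE_injective h).extend_apply]

theorem map_restrictResidual_residualLaw {d m n : ℕ} (A : ResidualBasis d) (h : m ≤ n) (δ : ℝ)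
    (β : Fin d → ℝ) (σ : ℝ) (x : Fin n → ℝ) (z : Fin n → Fin d → ℝ) :
    (residualLaw A δ β σ x z).map (restrictResidual A h z) =
      residualLaw A δ β σ (x ∘ Fin.castLE h) (z ∘ Fin.castLE h) := by
  have hm : Measurable fun y : Fin n → ℝ => y ∘ Fin.castLE h := by
    refine measurable_pi_iff.2 fun i => ?_
    simp only [Function.comp_apply]
    fun_prop
  have hr : responseLaw δ β σ (x ∘ Fin.castLE h) (z ∘ Fin.castLE h) =
      (responseLaw δ β σ x z).map fun y => y ∘ Fin.castLE h := by
    rw [responseLaw, responseLaw, map_restrict_pi]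
    rfl
  rw [residualLaw, residualLaw, hr, Measure.map_map (measurable_restrictResidual A h z)
    (by fun_prop), Measure.map_map (by fun_prop) hm]
  congr 1
  ext1 y
  exact restrictResidual_normalizedResidual A h z y

/-- The coarsened observation of the first `m` observations as a function of that of all `n`. -/
theorem exists_measurable_obs_restrict {d m n : ℕ} (A : ResidualBasis d) (h : m ≤ n) :
    ∃ F : (Σ k : ℕ, EuclideanSpace ℝ (Fin k)) × ((Fin n → ℝ) × (Fin n → Fin d → ℝ)) →
      (Σ k : ℕ, EuclideanSpace ℝ (Fin k)) × ((Fin m → ℝ) × (Fin m → Fin d → ℝ)),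
      Measurable F ∧ ∀ x z (u : EuclideanSpace ℝ (Fin (resDim z))),
        F (⟨resDim z, u⟩, x, z) = (⟨resDim (z ∘ Fin.castLE h), restrictResidual A h z u⟩,
          x ∘ Fin.castLE h, z ∘ Fin.castLE h) := by
  let f : (Σ k : ℕ, Fin k → Fin n → ℝ) × (Σ k : ℕ, EuclideanSpace ℝ (Fin k)) × Unit →
      Fin n → ℝ :=
    fun p => if h : p.2.1.1 = p.1.1 then
      (Matrix.of p.1.2)ᵀ *ᵥ (h ▸ p.2.1.2 : EuclideanSpace ℝ (Fin p.1.1)).ofLp else 0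
  have hmul : ∀ k : ℕ, Measurable fun p : (Fin k → Fin n → ℝ) × EuclideanSpace ℝ (Fin k) × Unit =>
      (Matrix.of p.1)ᵀ *ᵥ p.2.1.ofLp := by
    refine fun k => measurable_pi_iff.2 fun i => ?_
    simp only [Matrix.mulVec, dotProduct, Matrix.transpose_apply, Matrix.of_apply]
    fun_prop
  have hf : Measurable f := by
    refine measurable_of_measurable_sigma_mk_prod fun i j => ?_
    by_cases h : j = i
    · subst h
      simp only [f, dif_pos]
      exact hmul j
    · simp [f, h]
  have hg : Measurable fun p : (Σ k : ℕ, EuclideanSpace ℝ (Fin k)) ×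
      ((Fin n → ℝ) × (Fin n → Fin d → ℝ)) =>
      f (⟨resDim p.2.2, fun i j => A.mat n p.2.2 i j⟩, p.1, ()) :=
    hf.comp (((A.measurable n).comp measurable_snd.snd).prodMk
      (measurable_fst.prodMk measurable_const))
  have hr : ∀ {α : Type} [MeasurableSpace α],
      Measurable fun y : Fin n → α => y ∘ Fin.castLE h := fun {α} _ =>
    measurable_pi_iff.2 fun i => measurable_pi_apply (Fin.castLE h i)
  refine ⟨fun p => (⟨resDim (p.2.2 ∘ Fin.castLE h), normalizedResidual
      (A.mat m (p.2.2 ∘ Fin.castLE h))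
      (f (⟨resDim p.2.2, fun i j => A.mat n p.2.2 i j⟩, p.1, ()) ∘ Fin.castLE h)⟩,
      p.2.1 ∘ Fin.castLE h, p.2.2 ∘ Fin.castLE h), ?_, ?_⟩
  · exact ((measurable_sigma_normalizedResidual A m).comp
      ((hr.comp measurable_snd.snd).prodMk (hr.comp hg))).prodMk
      ((hr.comp measurable_snd.fst).prodMk (hr.comp measurable_snd.snd))
  · intro x z u
    simp only [f, dif_pos]
    rfl

/-! ### The supermartingale step for fixed covariates -/

/-- Let `μp` and `μ` have densities `φ ∘ T` and `ψ ∘ T` relative to `μ₀`, with `φ` nondecreasing and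
`ψ` nonincreasing, and let `q` be the density of the law of `g` under `μp` relative to its law under
`μ₀`; that is, `q ∘ g` is the conditional expectation of `φ ∘ T` given `g` under `μ₀`. Then its
conditional expectation under `μ` is at most `q ∘ g`. In place of a conditional Chebyshev
inequality, `ψ` is compared with its threshold value `ρ (q)`, where `ρ (c) = sup {ψ t | c < φ t}`:
the product `(φ - q) (ψ - ρ (q))` is nonpositive and `(φ - q) ρ (q)` integrates to `0` on events
determined by `g`. -/
theorem setLIntegral_comp_le_of_monotone_of_antitone {E E' : Type*} [MeasurableSpace E]
    [MeasurableSpace E'] {μ₀ : Measure E} {g : E → E'} (hg : Measurable g)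
    {T : E → ℝ} (hT : Measurable T) {φ ψ : ℝ → ℝ≥0∞} (hφ : Monotone φ) (hψ : Antitone ψ)
    {K : ℝ≥0∞} (hK : K ≠ ∞) (hψK : ∀ t, ψ t ≤ K) {q : E' → ℝ≥0∞} (hq : Measurable q)
    (hfin : ∫⁻ x, φ (T x) ∂μ₀ ≠ ∞)
    (hmap : (μ₀.withDensity fun x => φ (T x)).map g = (μ₀.map g).withDensity q)
    {S : Set E'} (hS : MeasurableSet S) :
    ∫⁻ x in g ⁻¹' S, φ (T x) ∂(μ₀.withDensity fun x => ψ (T x)) ≤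
      ∫⁻ x in g ⁻¹' S, q (g x) ∂(μ₀.withDensity fun x => ψ (T x)) := by
  set ρ : ℝ≥0∞ → ℝ≥0∞ := fun c => ⨆ t, ⨆ _ : c < φ t, ψ t with hρ
  have hρanti : Antitone ρ := fun c c' h =>
    iSup₂_le fun t ht => le_iSup₂_of_le t (h.trans_lt ht) le_rfl
  have hρm : Measurable ρ := hρanti.measurable
  have hρK : ∀ c, ρ c ≤ K := fun c => iSup₂_le fun t _ => hψK t
  have hφm : Measurable fun x => φ (T x) := hφ.measurable.comp hT
  have hψm : Measurable fun x => ψ (T x) := hψ.measurable.comp hT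
  have hqg : Measurable fun x => q (g x) := hq.comp hg
  have hρq' : Measurable fun y => ρ (q y) := hρm.comp hq
  have hρq : Measurable fun x => ρ (q (g x)) := hρm.comp hqg
  have hψφ : Measurable fun x => ψ (T x) * φ (T x) := hψm.mul hφm
  have hφρ : Measurable fun x => φ (T x) * ρ (q (g x)) := hφm.mul hρq
  have key : ∀ x, ψ (T x) * φ (T x) + ρ (q (g x)) * q (g x) ≤
      φ (T x) * ρ (q (g x)) + ψ (T x) * q (g x) := by
    intro x
    rcases lt_or_ge (q (g x)) (φ (T x)) with h | h
    · have h2 : ψ (T x) ≤ ρ (q (g x)) := le_iSup₂_of_le (T x) h le_rfl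
      calc _ = q (g x) * ρ (q (g x)) + φ (T x) * ψ (T x) := by ring
        _ ≤ q (g x) * ψ (T x) + φ (T x) * ρ (q (g x)) := mul_add_mul_le_of_le_of_le h.le h2
        _ = _ := by ring
    · have h2 : ρ (q (g x)) ≤ ψ (T x) :=
        iSup₂_le fun t ht => hψ (hφ.reflect_lt (h.trans_lt ht)).le
      calc _ = φ (T x) * ψ (T x) + q (g x) * ρ (q (g x)) := by ring
        _ ≤ φ (T x) * ρ (q (g x)) + q (g x) * ψ (T x) := mul_add_mul_le_of_le_of_le h h2
        _ = _ := by ring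
  have hgS : MeasurableSet (g ⁻¹' S) := hg hS
  have hI : ∫⁻ x in g ⁻¹' S, φ (T x) * ρ (q (g x)) ∂μ₀ =
      ∫⁻ x in g ⁻¹' S, ρ (q (g x)) * q (g x) ∂μ₀ := by
    have h1 : ∫⁻ y in S, ρ (q y) ∂((μ₀.withDensity fun x => φ (T x)).map g) =
        ∫⁻ y in S, ρ (q y) ∂((μ₀.map g).withDensity q) := by rw [hmap]
    rw [setLIntegral_map hS hρq' hg,
      setLIntegral_withDensity_eq_setLIntegral_mul _ hφm hρq hgS,
      setLIntegral_withDensity_eq_setLIntegral_mul _ hq hρq' hS,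
      setLIntegral_map hS (hq.mul hρq') hg] at h1
    simp only [Pi.mul_apply] at h1
    rw [h1]
    exact lintegral_congr fun x => mul_comm _ _
  have hIfin : ∫⁻ x in g ⁻¹' S, φ (T x) * ρ (q (g x)) ∂μ₀ ≠ ∞ := by
    refine ne_top_of_le_ne_top (ENNReal.mul_ne_top hfin hK) ?_
    rw [← lintegral_mul_const _ hφm]
    refine (setLIntegral_le_lintegral _ _).trans (lintegral_mono fun x => ?_)
    gcongr
    exact hρK _
  have hle := lintegral_mono (μ := μ₀.restrict (g ⁻¹' S)) key
  rw [lintegral_add_left hψφ, lintegral_add_left hφρ, ← hI, add_comm] at hle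
  rw [setLIntegral_withDensity_eq_setLIntegral_mul _ hψm hφm hgS,
    setLIntegral_withDensity_eq_setLIntegral_mul _ hψm hqg hgS]
  exact (ENNReal.add_le_add_iff_left hIfin).1 hle

/-- The ratio of the densities of the direction at effect sizes `δ'` and `δ`, as a function of the
inner product `s` of the direction with `b`, where `r = ‖b‖` and `ν = k - 1`. -/
def directionRatio (ν : ℕ) (δ δ' r s : ℝ) : ℝ :=
  Real.exp (-(δ' * r) ^ 2 / 2) / Real.exp (-(δ * r) ^ 2 / 2) *
    (tiltedMoment ν (δ' * s) / tiltedMoment ν (δ * s))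

theorem directionDensity_div {k : ℕ} (δ δ' : ℝ) (b u : EuclideanSpace ℝ (Fin k)) :
    directionDensity (δ' • b) u / directionDensity (δ • b) u =
      directionRatio (k - 1) δ δ' ‖b‖ (inner ℝ b u) := by
  have hC : (2 * Real.pi) ^ (-(k : ℝ) / 2) ≠ 0 := by positivity
  simp only [directionDensity, directionRatio, real_inner_smul_left, norm_smul, mul_pow,
    Real.norm_eq_abs, sq_abs]
  rw [mul_assoc, mul_assoc, mul_div_mul_left _ _ hC, mul_div_mul_comm]

theorem monotone_directionRatio (ν : ℕ) {δ δ' : ℝ} (h : δ ≤ δ') (r : ℝ) :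
    Monotone (directionRatio ν δ δ' r) :=
  (monotone_tiltedMoment_ratio ν h).const_mul (by positivity)

theorem antitone_directionRatio (ν : ℕ) {δ δ' : ℝ} (h : δ' ≤ δ) (r : ℝ) :
    Antitone (directionRatio ν δ δ' r) := by
  have hpos := tiltedMoment_pos ν
  have hanti : Antitone fun s => tiltedMoment ν (δ' * s) / tiltedMoment ν (δ * s) := by
    intro s t hst
    have := monotone_tiltedMoment_ratio ν h hst
    simp only [div_le_div_iff₀ (hpos _) (hpos _)] at this ⊢
    linarith
  exact hanti.const_mul (by positivity)

/-- The martingale property for fixed covariates: the likelihood ratio at time `m` is the density of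
the image law. -/
theorem setLIntegral_likelihoodRatio_eq {d m n : ℕ} (A : ResidualBasis d) (h : m ≤ n) (δ₀ δp : ℝ)
    (β : Fin d → ℝ) {σ : ℝ} (hσ : 0 < σ) (x : Fin n → ℝ) (z : Fin n → Fin d → ℝ)
    {S : Set (EuclideanSpace ℝ (Fin (resDim (z ∘ Fin.castLE h))))} (hS : MeasurableSet S) :
    ∫⁻ u in restrictResidual A h z ⁻¹' S, ENNReal.ofReal (likelihoodRatio A δ₀ δp x z u)
        ∂residualLaw A δ₀ β σ x z =
      ∫⁻ u in restrictResidual A h z ⁻¹' S, ENNReal.ofReal (likelihoodRatio A δ₀ δp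
        (x ∘ Fin.castLE h) (z ∘ Fin.castLE h) (restrictResidual A h z u))
        ∂residualLaw A δ₀ β σ x z := by
  have hg := measurable_restrictResidual A h z
  rw [← withDensity_apply _ (hg hS),
    ← residualLaw_eq_withDensity_likelihoodRatio A δ₀ δp β β hσ hσ x z,
    ← Measure.map_apply hg hS, map_restrictResidual_residualLaw,
    ← setLIntegral_map (g := restrictResidual A h z) hS
      (measurable_likelihoodRatio A δ₀ δp (x ∘ Fin.castLE h)
        (z ∘ Fin.castLE h)).ennreal_ofReal hg, map_restrictResidual_residualLaw,
    ← withDensity_apply _ hS, ← residualLaw_eq_withDensity_likelihoodRatio A δ₀ δp β β hσ hσ]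

/-- The supermartingale inequality for fixed covariates. -/
theorem setLIntegral_likelihoodRatio_le {d m n : ℕ} (A : ResidualBasis d) (h : m ≤ n)
    {δ δ₀ δp : ℝ} (hδ : δ ≤ δ₀) (hδp : δ₀ ≤ δp)
    (β : Fin d → ℝ) {σ : ℝ} (hσ : 0 < σ) (x : Fin n → ℝ) (z : Fin n → Fin d → ℝ)
    {S : Set (EuclideanSpace ℝ (Fin (resDim (z ∘ Fin.castLE h))))} (hS : MeasurableSet S) :
    ∫⁻ u in restrictResidual A h z ⁻¹' S, ENNReal.ofReal (likelihoodRatio A δ₀ δp x z u)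
        ∂residualLaw A δ β σ x z ≤
      ∫⁻ u in restrictResidual A h z ⁻¹' S, ENNReal.ofReal (likelihoodRatio A δ₀ δp
        (x ∘ Fin.castLE h) (z ∘ Fin.castLE h) (restrictResidual A h z u))
        ∂residualLaw A δ β σ x z := by
  rcases Nat.eq_zero_or_pos (resDim z) with hk | hk
  · have h0 := setLIntegral_likelihoodRatio_eq A h δ₀ δp β hσ x z hS
    rw [residualLaw_eq_dirac A δ₀ β σ x z hk] at h0
    rw [residualLaw_eq_dirac A δ β σ x z hk, h0]
  set b := compress (A.mat n z) x with hb
  set φ : ℝ → ℝ≥0∞ := fun s => ENNReal.ofReal (directionRatio (resDim z - 1) δ₀ δp ‖b‖ s) with hφ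
  -- the direction is a unit vector, so the ratio may be frozen below `-‖b‖`, which bounds it
  set ψ : ℝ → ℝ≥0∞ := fun s =>
    ENNReal.ofReal (directionRatio (resDim z - 1) δ₀ δ ‖b‖ (max s (-‖b‖))) with hψ
  have hφm : Monotone φ := fun s t hst =>
    ENNReal.ofReal_le_ofReal (monotone_directionRatio _ hδp _ hst)
  have hψa : Antitone ψ := fun s t hst =>
    ENNReal.ofReal_le_ofReal (antitone_directionRatio _ hδ _ (max_le_max_right _ hst))
  have hψK : ∀ s, ψ s ≤ ENNReal.ofReal (directionRatio (resDim z - 1) δ₀ δ ‖b‖ (-‖b‖)) := fun s =>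
    ENNReal.ofReal_le_ofReal (antitone_directionRatio _ hδ _ (le_max_right _ _))
  have hac := residualLaw_absolutelyContinuous A δ₀ β hσ x z hk
  have hμp : residualLaw A δp β σ x z =
      (residualLaw A δ₀ β σ x z).withDensity fun u => φ (inner ℝ b u) := by
    rw [residualLaw_eq_withDensity_div A δ₀ δp β β hσ hσ x z hk]
    simp only [directionDensity_div]
    rfl
  have hμ : residualLaw A δ β σ x z =
      (residualLaw A δ₀ β σ x z).withDensity fun u => ψ (inner ℝ b u) := by
    rw [residualLaw_eq_withDensity_div A δ₀ δ β β hσ hσ x z hk]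
    refine withDensity_congr_ae ?_
    filter_upwards [hac.ae_le (ae_norm_eq_one_sphereMeasure _)] with u hu
    have hle : -‖b‖ ≤ inner ℝ b u := by
      have := (abs_le.1 (abs_real_inner_le_norm b u)).1
      rwa [hu, mul_one] at this
    rw [directionDensity_div]
    simp only [hψ, max_eq_left hle]
    rfl
  have hfin : ∫⁻ u, φ (inner ℝ b u) ∂residualLaw A δ₀ β σ x z ≠ ∞ := by
    have h1 : residualLaw A δp β σ x z Set.univ ≠ ∞ := measure_ne_top _ _
    rwa [hμp, withDensity_apply _ .univ, Measure.restrict_univ] at h1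
  have hmap : ((residualLaw A δ₀ β σ x z).withDensity fun u => φ (inner ℝ b u)).map
      (restrictResidual A h z) = ((residualLaw A δ₀ β σ x z).map
        (restrictResidual A h z)).withDensity fun u => ENNReal.ofReal (likelihoodRatio A δ₀ δp
          (x ∘ Fin.castLE h) (z ∘ Fin.castLE h) u) := by
    rw [← hμp, map_restrictResidual_residualLaw, map_restrictResidual_residualLaw]
    exact residualLaw_eq_withDensity_likelihoodRatio A δ₀ δp β β hσ hσ _ _
  have hmain := setLIntegral_comp_le_of_monotone_of_antitone
    (measurable_restrictResidual A h z) (T := fun u => inner ℝ b u) (by fun_prop) hφm hψa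
    ENNReal.ofReal_ne_top hψK (measurable_likelihoodRatio A δ₀ δp _ _).ennreal_ofReal hfin hmap hS
  rw [← hμ] at hmain
  refine le_trans (le_of_eq ?_) hmain
  refine lintegral_congr_ae (ae_restrict_of_ae ?_)
  filter_upwards [(residualLaw_absolutelyContinuous A δ β hσ x z hk).ae_le
    (ae_likelihoodRatio_eq A δ₀ δp x z hk)] with u hu
  rw [hu, directionDensity_div]

/-! ### The conditional law given the covariates -/

section Sequential

variable {Ω : Type*} [MeasurableSpace Ω] {d : ℕ} {P : Measure Ω} [IsProbabilityMeasure P]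
  {X Y : ℕ → Ω → ℝ} {Z : ℕ → Ω → Fin d → ℝ} {δ : ℝ} {β : Fin d → ℝ} {σ : ℝ}

theorem measurable_covariates (hX : ∀ i, Measurable (X i)) (hZ : ∀ i, Measurable (Z i)) (n : ℕ) :
    Measurable (covariates X Z n) :=
  have hx : Measurable (firstN X n) := measurable_pi_iff.2 fun i => hX i
  have hz : Measurable (firstN Z n) := measurable_pi_iff.2 fun i => hZ i
  hx.prodMk hz

/-- The response as a measurable function of the covariates and the noise. -/
theorem measurable_response (n : ℕ) (δ : ℝ) (β : Fin d → ℝ) (σ : ℝ) :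
    Measurable fun p : ((Fin n → ℝ) × (Fin n → Fin d → ℝ)) × (Fin n → ℝ) =>
      fun i => δ * σ * p.1.1 i + β ⬝ᵥ p.1.2 i + σ * p.2 i := by
  refine measurable_pi_iff.2 fun i => ?_
  simp only [dotProduct]
  fun_prop

/-- Given the covariates, the response has law `responseLaw`. -/
theorem IsLinearModel.lintegral_response (hM : IsLinearModel P X Y Z δ β σ)
    (hX : ∀ i, Measurable (X i)) (hZ : ∀ i, Measurable (Z i)) (n : ℕ)
    {H : ((Fin n → ℝ) × (Fin n → Fin d → ℝ)) × (Fin n → ℝ) → ℝ≥0∞} (hH : Measurable H) :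
    ∫⁻ ω, H (covariates X Z n ω, firstN Y n ω) ∂P =
      ∫⁻ c, ∫⁻ y, H (c, y) ∂responseLaw δ β σ c.1 c.2 ∂(P.map (covariates X Z n)) := by
  obtain ⟨ε, hε, hlaw, hiind, hind, hY⟩ := hM.exists_noise
  have hcov := measurable_covariates hX hZ n
  have hεn : Measurable (firstN ε n) := measurable_pi_iff.2 fun i => hε i
  have hind' : IndepFun (covariates X Z n) (firstN ε n) P := by
    have h1 : Measurable fun s : ℕ → ℝ × (Fin d → ℝ) =>
        ((fun i : Fin n => (s i).1), fun i : Fin n => (s i).2) := by fun_prop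
    have h2 : Measurable fun (s : ℕ → ℝ) (i : Fin n) => s i := by fun_prop
    exact hind.symm.comp h1 h2
  have hmapε : P.map (firstN ε n) = Measure.pi fun _ : Fin n => gaussianReal 0 1 := by
    have h1 := hiind.precomp (g := fun i : Fin n => (i : ℕ)) Fin.val_injective
    have h2 := (iIndepFun_iff_map_fun_eq_pi_map fun i : Fin n => (hε i).aemeasurable).1 h1
    simp only [hlaw] at h2
    exact h2
  have hjoint := (indepFun_iff_map_prod_eq_prod_map_map hcov.aemeasurable hεn.aemeasurable).1 hind'
  have hresp := measurable_response n δ β σ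
  have hH' : Measurable fun p : ((Fin n → ℝ) × (Fin n → Fin d → ℝ)) × (Fin n → ℝ) =>
      H (p.1, fun i => δ * σ * p.1.1 i + β ⬝ᵥ p.1.2 i + σ * p.2 i) :=
    hH.comp (measurable_fst.prodMk hresp)
  have hYn : ∀ ω, firstN Y n ω = fun i : Fin n => δ * σ * (covariates X Z n ω).1 i +
      β ⬝ᵥ (covariates X Z n ω).2 i + σ * firstN ε n ω i := fun ω => funext fun i => hY i ω
  simp only [hYn]
  rw [← lintegral_map (g := fun ω => (covariates X Z n ω, firstN ε n ω)) hH'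
    (hcov.prodMk hεn), hjoint, hmapε, lintegral_prod _ hH'.aemeasurable]
  refine lintegral_congr fun c => ?_
  have hrc : Measurable fun (e : Fin n → ℝ) (i : Fin n) => δ * σ * c.1 i + β ⬝ᵥ c.2 i + σ * e i :=
    hresp.comp measurable_prodMk_left
  have hHc : Measurable fun y : Fin n → ℝ => H (c, y) := hH.comp measurable_prodMk_left
  rw [responseLaw_eq_map, lintegral_map hHc hrc]

/-- Given the covariates, the residual direction has law `residualLaw`. -/
theorem IsLinearModel.lintegral_obsM (hM : IsLinearModel P X Y Z δ β σ) (A : ResidualBasis d)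
    (hX : ∀ i, Measurable (X i)) (hZ : ∀ i, Measurable (Z i)) (n : ℕ)
    {G : (Σ k : ℕ, EuclideanSpace ℝ (Fin k)) × ((Fin n → ℝ) × (Fin n → Fin d → ℝ)) → ℝ≥0∞}
    (hG : Measurable G) :
    ∫⁻ ω, G (obsM A X Y Z n ω) ∂P =
      ∫⁻ c, ∫⁻ u, G (⟨resDim c.2, u⟩, c) ∂residualLaw A δ β σ c.1 c.2
        ∂(P.map (covariates X Z n)) := by
  have hobs : Measurable fun p : ((Fin n → ℝ) × (Fin n → Fin d → ℝ)) × (Fin n → ℝ) =>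
      ((⟨resDim p.1.2, normalizedResidual (A.mat n p.1.2) p.2⟩ :
        Σ k : ℕ, EuclideanSpace ℝ (Fin k)), p.1) :=
    ((measurable_sigma_normalizedResidual A n).comp
      (measurable_fst.snd.prodMk measurable_snd)).prodMk measurable_fst
  refine (hM.lintegral_response hX hZ n (hG.comp hobs)).trans (lintegral_congr fun c => ?_)
  have hGc : Measurable fun u : EuclideanSpace ℝ (Fin (resDim c.2)) =>
      G (⟨resDim c.2, u⟩, c) :=
    hG.comp ((measurableEmbedding_sigma_mk (α := fun k => EuclideanSpace ℝ (Fin k))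
      (resDim c.2)).measurable.prodMk measurable_const)
  rw [residualLaw, lintegral_map hGc (measurable_normalizedResidual _)]
  rfl

theorem measurable_residualLaw_apply (A : ResidualBasis d) (δ : ℝ) (β : Fin d → ℝ) (σ : ℝ) (n : ℕ)
    {B : Set (Σ k : ℕ, EuclideanSpace ℝ (Fin k))} (hB : MeasurableSet B) :
    Measurable fun c : (Fin n → ℝ) × (Fin n → Fin d → ℝ) => residualLaw A δ β σ c.1 c.2
      {u | (⟨resDim c.2, u⟩ : Σ k : ℕ, EuclideanSpace ℝ (Fin k)) ∈ B} := by
  have hs : MeasurableSet {p : ((Fin n → ℝ) × (Fin n → Fin d → ℝ)) × (Fin n → ℝ) |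
      (⟨resDim p.1.2, normalizedResidual (A.mat n p.1.2)
        (fun i => δ * σ * p.1.1 i + β ⬝ᵥ p.1.2 i + σ * p.2 i)⟩ :
        Σ k : ℕ, EuclideanSpace ℝ (Fin k)) ∈ B} :=
    (measurable_sigma_normalizedResidual A n).comp
      (measurable_fst.snd.prodMk (measurable_response n δ β σ)) hB
  convert! measurable_measure_prodMk_left (ν := Measure.pi fun _ : Fin n => gaussianReal 0 1)
    hs using 2 with c
  have hBc : MeasurableSet {u : EuclideanSpace ℝ (Fin (resDim c.2)) |
      (⟨resDim c.2, u⟩ : Σ k : ℕ, EuclideanSpace ℝ (Fin k)) ∈ B} :=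
    (measurableEmbedding_sigma_mk (α := fun k => EuclideanSpace ℝ (Fin k))
      (resDim c.2)).measurable hB
  have hresp : Measurable fun (e : Fin n → ℝ) (i : Fin n) =>
      δ * σ * c.1 i + β ⬝ᵥ c.2 i + σ * e i :=
    (measurable_response n δ β σ).comp measurable_prodMk_left
  rw [residualLaw, responseLaw_eq_map, Measure.map_map (measurable_normalizedResidual _) hresp,
    Measure.map_apply ((measurable_normalizedResidual _).comp hresp) hBc]
  rfl

theorem IsLinearModel.condExp_residualSigma (hM : IsLinearModel P X Y Z δ β σ)
    (A : ResidualBasis d) (hX : ∀ i, Measurable (X i)) (hY : ∀ i, Measurable (Y i))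
    (hZ : ∀ i, Measurable (Z i)) (n : ℕ) {B : Set (Σ k : ℕ, EuclideanSpace ℝ (Fin k))}
    (hB : MeasurableSet B) :
    P⟦residualSigma A Y Z n ⁻¹' B | MeasurableSpace.comap (covariates X Z n) inferInstance⟧
      =ᵐ[P] fun ω => (residualLaw A δ β σ (firstN X n ω) (firstN Z n ω)).real
        {u | (⟨resDim (firstN Z n ω), u⟩ : Σ k : ℕ, EuclideanSpace ℝ (Fin k)) ∈ B} := by
  have hcov := measurable_covariates hX hZ n
  have hU := measurable_residualSigma A hY hZ n
  have hUB : MeasurableSet (residualSigma A Y Z n ⁻¹' B) := hU hB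
  set κ : (Fin n → ℝ) × (Fin n → Fin d → ℝ) → ℝ≥0∞ := fun c => residualLaw A δ β σ c.1 c.2
    {u | (⟨resDim c.2, u⟩ : Σ k : ℕ, EuclideanSpace ℝ (Fin k)) ∈ B} with hκ
  have hκm : Measurable κ := measurable_residualLaw_apply A δ β σ n hB
  have hκ1 : ∀ c, κ c ≤ 1 := fun c => prob_le_one
  have hκt : ∀ c, κ c < ∞ := fun c => (hκ1 c).trans_lt ENNReal.one_lt_top
  have hint : Integrable (fun ω => (κ (covariates X Z n ω)).toReal) P := by
    refine integrable_toReal_of_lintegral_ne_top (hκm.comp hcov).aemeasurable ?_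
    refine ne_top_of_le_ne_top ENNReal.one_ne_top ?_
    calc ∫⁻ ω, κ (covariates X Z n ω) ∂P ≤ ∫⁻ _, 1 ∂P := lintegral_mono fun ω => hκ1 _
      _ = 1 := by simp
  refine (ae_eq_condExp_of_forall_setIntegral_eq hcov.comap_le
    ((integrable_const (1 : ℝ)).indicator hUB) (fun s _ _ => hint.integrableOn) ?_ ?_).symm
  · rintro _ ⟨C, hC, rfl⟩ _
    have hCm := hcov hC
    have hG : Measurable ((B ×ˢ C).indicator fun _ => (1 : ℝ≥0∞)) :=
      measurable_const.indicator (hB.prod hC)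
    have h := hM.lintegral_obsM A hX hZ n hG
    have hl : ∫⁻ ω, (B ×ˢ C).indicator (fun _ => (1 : ℝ≥0∞)) (obsM A X Y Z n ω) ∂P =
        P (residualSigma A Y Z n ⁻¹' B ∩ covariates X Z n ⁻¹' C) := by
      rw [← lintegral_indicator_one (hUB.inter hCm)]
      rfl
    have hr : ∀ c : (Fin n → ℝ) × (Fin n → Fin d → ℝ),
        ∫⁻ u, (B ×ˢ C).indicator (fun _ => (1 : ℝ≥0∞)) (⟨resDim c.2, u⟩, c)
          ∂residualLaw A δ β σ c.1 c.2 = C.indicator κ c := by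
      intro c
      have hBc : MeasurableSet {u : EuclideanSpace ℝ (Fin (resDim c.2)) |
          (⟨resDim c.2, u⟩ : Σ k : ℕ, EuclideanSpace ℝ (Fin k)) ∈ B} :=
        (measurableEmbedding_sigma_mk (α := fun k => EuclideanSpace ℝ (Fin k))
          (resDim c.2)).measurable hB
      by_cases hc : c ∈ C
      · rw [Set.indicator_of_mem hc, hκ]
        simp only
        rw [← lintegral_indicator_one hBc]
        refine lintegral_congr fun u => ?_
        have hm : ((⟨resDim c.2, u⟩ : Σ k : ℕ, EuclideanSpace ℝ (Fin k)), c) ∈ B ×ˢ C ↔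
            (⟨resDim c.2, u⟩ : Σ k : ℕ, EuclideanSpace ℝ (Fin k)) ∈ B :=
          and_iff_left hc
        by_cases hu : (⟨resDim c.2, u⟩ : Σ k : ℕ, EuclideanSpace ℝ (Fin k)) ∈ B
        · rw [Set.indicator_of_mem (hm.2 hu), Set.indicator_of_mem (by exact hu), Pi.one_apply]
        · rw [Set.indicator_of_notMem (hu ∘ hm.1), Set.indicator_of_notMem (by exact hu)]
      · rw [Set.indicator_of_notMem hc, ← lintegral_zero]
        refine lintegral_congr fun u => ?_
        rw [Set.indicator_of_notMem]
        simp [hc]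
    simp only [hr] at h
    rw [hl, lintegral_map (hκm.indicator hC) hcov] at h
    have h' : ∫⁻ ω in covariates X Z n ⁻¹' C, κ (covariates X Z n ω) ∂P =
        P (residualSigma A Y Z n ⁻¹' B ∩ covariates X Z n ⁻¹' C) := by
      rw [h, ← lintegral_indicator hCm]
      rfl
    rw [setIntegral_indicator hUB, setIntegral_const, smul_eq_mul, mul_one, Set.inter_comm,
      measureReal_def, ← h']
    exact integral_toReal (hκm.comp hcov).aemeasurable (Filter.Eventually.of_forall fun ω => hκt _)
  · exact (Measurable.stronglyMeasurable
      (hκm.ennreal_toReal.comp (comap_measurable _))).aestronglyMeasurable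

end Sequential

/-! ### The likelihood ratio process -/

theorem likelihoodRatioProcess_eq_obs {Ω : Type*} {d : ℕ} {X Y : ℕ → Ω → ℝ}
    {Z : ℕ → Ω → Fin d → ℝ} (A : ResidualBasis d) (δ₀ δp : ℝ) (n : ℕ) (ω : Ω) :
    likelihoodRatioProcess A δ₀ δp X Y Z n ω =
      likelihoodRatioObs A δ₀ δp n (obsM A X Y Z n ω) :=
  (likelihoodRatioObs_mk A δ₀ δp _ _ _).symm

theorem likelihoodRatioProcess_nonneg {Ω : Type*} {d : ℕ} {X Y : ℕ → Ω → ℝ}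
    {Z : ℕ → Ω → Fin d → ℝ} (A : ResidualBasis d) (δ₀ δp : ℝ) (n : ℕ) (ω : Ω) :
    0 ≤ likelihoodRatioProcess A δ₀ δp X Y Z n ω :=
  likelihoodRatio_nonneg A δ₀ δp _ _ _

theorem likelihoodRatioProcess_zero {Ω : Type*} {d : ℕ} {X Y : ℕ → Ω → ℝ}
    {Z : ℕ → Ω → Fin d → ℝ} (A : ResidualBasis d) (δ₀ δp : ℝ) (ω : Ω) :
    likelihoodRatioProcess A δ₀ δp X Y Z 0 ω = 1 :=
  likelihoodRatio_eq_one A δ₀ δp _ _ (Nat.zero_sub _) _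

section Sequential

variable {Ω : Type*} [MeasurableSpace Ω] {d : ℕ} {P : Measure Ω} [IsProbabilityMeasure P]
  {X Y : ℕ → Ω → ℝ} {Z : ℕ → Ω → Fin d → ℝ} {δ : ℝ} {β : Fin d → ℝ} {σ : ℝ}

/-- The filtration at time `n` is generated by the last coarsened observation. -/
theorem obsFiltration_le_comap (A : ResidualBasis d) (hX : ∀ i, Measurable (X i))
    (hY : ∀ i, Measurable (Y i)) (hZ : ∀ i, Measurable (Z i)) (n : ℕ) :
    obsFiltration A hX hY hZ n ≤ MeasurableSpace.comap (obsM A X Y Z n) inferInstance := by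
  refine iSup₂_le fun m hm => ?_
  obtain ⟨F, hF, hFobs⟩ := exists_measurable_obs_restrict A hm
  have h : obsM A X Y Z m = F ∘ obsM A X Y Z n := by
    ext1 ω
    refine Eq.trans ?_ (hFobs (firstN X n ω) (firstN Z n ω) (residualU A Y Z n ω)).symm
    rw [residualU, restrictResidual_normalizedResidual]
    rfl
  rw [h, ← MeasurableSpace.comap_comp]
  exact MeasurableSpace.comap_mono hF.comap_le

theorem stronglyAdapted_likelihoodRatioProcess (A : ResidualBasis d) (hX : ∀ i, Measurable (X i))
    (hY : ∀ i, Measurable (Y i)) (hZ : ∀ i, Measurable (Z i)) (δ₀ δp : ℝ) :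
    StronglyAdapted (obsFiltration A hX hY hZ) (likelihoodRatioProcess A δ₀ δp X Y Z) := by
  intro n
  have h1 : MeasurableSpace.comap (obsM A X Y Z n) inferInstance ≤ obsFiltration A hX hY hZ n :=
    le_iSup₂_of_le n le_rfl le_rfl
  have h2 : likelihoodRatioProcess A δ₀ δp X Y Z n =
      likelihoodRatioObs A δ₀ δp n ∘ obsM A X Y Z n :=
    funext fun ω => likelihoodRatioProcess_eq_obs A δ₀ δp n ω
  rw [h2]
  exact Measurable.stronglyMeasurable
    ((measurable_likelihoodRatioObs A δ₀ δp n).comp ((comap_measurable _).mono h1 le_rfl))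

/-- Conditioning on the covariates reduces the comparison of the process at two times to the case of
fixed covariates. -/
theorem IsLinearModel.setLIntegral_likelihoodRatioProcess (hM : IsLinearModel P X Y Z δ β σ)
    (A : ResidualBasis d) (hX : ∀ i, Measurable (X i)) (hY : ∀ i, Measurable (Y i))
    (hZ : ∀ i, Measurable (Z i)) (δ₀ δp : ℝ) {m n : ℕ} (h : m ≤ n) {s : Set Ω}
    (hs : MeasurableSet[obsFiltration A hX hY hZ m] s) :
    ∃ S : ∀ c : (Fin n → ℝ) × (Fin n → Fin d → ℝ),
      Set (EuclideanSpace ℝ (Fin (resDim (c.2 ∘ Fin.castLE h)))),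
      (∀ c, MeasurableSet (S c)) ∧
      ∫⁻ ω in s, ENNReal.ofReal (likelihoodRatioProcess A δ₀ δp X Y Z n ω) ∂P =
        ∫⁻ c, ∫⁻ u in restrictResidual A h c.2 ⁻¹' S c,
          ENNReal.ofReal (likelihoodRatio A δ₀ δp c.1 c.2 u) ∂residualLaw A δ β σ c.1 c.2
          ∂(P.map (covariates X Z n)) ∧
      ∫⁻ ω in s, ENNReal.ofReal (likelihoodRatioProcess A δ₀ δp X Y Z m ω) ∂P =
        ∫⁻ c, ∫⁻ u in restrictResidual A h c.2 ⁻¹' S c,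
          ENNReal.ofReal (likelihoodRatio A δ₀ δp (c.1 ∘ Fin.castLE h) (c.2 ∘ Fin.castLE h)
            (restrictResidual A h c.2 u)) ∂residualLaw A δ β σ c.1 c.2
          ∂(P.map (covariates X Z n)) := by
  obtain ⟨B, hB, rfl⟩ := obsFiltration_le_comap A hX hY hZ m s hs
  obtain ⟨F, hF, hFobs⟩ := exists_measurable_obs_restrict A h
  have hobs : ∀ ω, obsM A X Y Z m ω = F (obsM A X Y Z n ω) := by
    intro ω
    refine Eq.trans ?_ (hFobs (firstN X n ω) (firstN Z n ω) (residualU A Y Z n ω)).symm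
    rw [residualU, restrictResidual_normalizedResidual]
    rfl
  have hBm : MeasurableSet (obsM A X Y Z m ⁻¹' B) := measurable_obsM A hX hY hZ m hB
  have hSm : ∀ c : (Fin n → ℝ) × (Fin n → Fin d → ℝ), MeasurableSet
      {u : EuclideanSpace ℝ (Fin (resDim (c.2 ∘ Fin.castLE h))) |
        ((⟨_, u⟩ : Σ k : ℕ, EuclideanSpace ℝ (Fin k)), c.1 ∘ Fin.castLE h,
          c.2 ∘ Fin.castLE h) ∈ B} := fun c =>
    ((measurableEmbedding_sigma_mk (α := fun k => EuclideanSpace ℝ (Fin k))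
      (resDim (c.2 ∘ Fin.castLE h))).measurable.prodMk measurable_const) hB
  -- integrals over the event of functions of the observation at time `n`
  have key : ∀ G : (Σ k : ℕ, EuclideanSpace ℝ (Fin k)) × ((Fin n → ℝ) × (Fin n → Fin d → ℝ)) →
      ℝ≥0∞, Measurable G → ∫⁻ ω in obsM A X Y Z m ⁻¹' B, G (obsM A X Y Z n ω) ∂P =
      ∫⁻ c, ∫⁻ u in restrictResidual A h c.2 ⁻¹'
        {u | ((⟨_, u⟩ : Σ k : ℕ, EuclideanSpace ℝ (Fin k)), c.1 ∘ Fin.castLE h,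
          c.2 ∘ Fin.castLE h) ∈ B},
        G (⟨resDim c.2, u⟩, c) ∂residualLaw A δ β σ c.1 c.2 ∂(P.map (covariates X Z n)) := by
    intro G hG
    have h1 := hM.lintegral_obsM A hX hZ n (hG.indicator (hF hB))
    rw [← lintegral_indicator hBm]
    refine Eq.trans (lintegral_congr fun ω => ?_) (h1.trans (lintegral_congr fun c => ?_))
    · have hm : ω ∈ obsM A X Y Z m ⁻¹' B ↔ obsM A X Y Z n ω ∈ F ⁻¹' B := by
        rw [Set.mem_preimage, Set.mem_preimage, hobs]
      by_cases hω : obsM A X Y Z n ω ∈ F ⁻¹' B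
      · rw [Set.indicator_of_mem hω, Set.indicator_of_mem (hm.2 hω)]
      · rw [Set.indicator_of_notMem hω, Set.indicator_of_notMem fun h' => hω (hm.1 h')]
    · rw [← lintegral_indicator (measurable_restrictResidual A h c.2 (hSm c))]
      refine lintegral_congr fun u => ?_
      have hm : ((⟨resDim c.2, u⟩ : Σ k : ℕ, EuclideanSpace ℝ (Fin k)), c) ∈ F ⁻¹' B ↔
          u ∈ restrictResidual A h c.2 ⁻¹'
            {u | ((⟨_, u⟩ : Σ k : ℕ, EuclideanSpace ℝ (Fin k)), c.1 ∘ Fin.castLE h,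
              c.2 ∘ Fin.castLE h) ∈ B} := by
        rw [Set.mem_preimage, hFobs c.1 c.2 u]
        rfl
      by_cases hu : ((⟨resDim c.2, u⟩ : Σ k : ℕ, EuclideanSpace ℝ (Fin k)), c) ∈ F ⁻¹' B
      · rw [Set.indicator_of_mem hu, Set.indicator_of_mem (hm.1 hu)]
      · rw [Set.indicator_of_notMem hu, Set.indicator_of_notMem fun h' => hu (hm.2 h')]
  refine ⟨_, hSm, ?_, ?_⟩
  · simp only [likelihoodRatioProcess_eq_obs]
    rw [key (fun p => ENNReal.ofReal (likelihoodRatioObs A δ₀ δp n p))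
      (measurable_likelihoodRatioObs A δ₀ δp n).ennreal_ofReal]
    refine lintegral_congr fun c => lintegral_congr fun u => ?_
    rw [← likelihoodRatioObs_mk]
  · simp only [likelihoodRatioProcess_eq_obs, hobs]
    rw [key (fun p => ENNReal.ofReal (likelihoodRatioObs A δ₀ δp m (F p)))
      ((measurable_likelihoodRatioObs A δ₀ δp m).comp hF).ennreal_ofReal]
    refine lintegral_congr fun c => lintegral_congr fun u => ?_
    rw [hFobs c.1 c.2 u, likelihoodRatioObs_mk]

theorem IsLinearModel.setLIntegral_likelihoodRatioProcess_le (hM : IsLinearModel P X Y Z δ β σ)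
    (hσ : 0 < σ) (A : ResidualBasis d) (hX : ∀ i, Measurable (X i)) (hY : ∀ i, Measurable (Y i))
    (hZ : ∀ i, Measurable (Z i)) {δ₀ δp : ℝ} (hδ : δ ≤ δ₀) (hδp : δ₀ ≤ δp) {m n : ℕ} (h : m ≤ n)
    {s : Set Ω} (hs : MeasurableSet[obsFiltration A hX hY hZ m] s) :
    ∫⁻ ω in s, ENNReal.ofReal (likelihoodRatioProcess A δ₀ δp X Y Z n ω) ∂P ≤
      ∫⁻ ω in s, ENNReal.ofReal (likelihoodRatioProcess A δ₀ δp X Y Z m ω) ∂P := by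
  obtain ⟨S, hS, h1, h2⟩ := hM.setLIntegral_likelihoodRatioProcess A hX hY hZ δ₀ δp h hs
  rw [h1, h2]
  exact lintegral_mono fun c => setLIntegral_likelihoodRatio_le A h hδ hδp β hσ c.1 c.2 (hS c)

theorem IsLinearModel.setLIntegral_likelihoodRatioProcess_eq {δ₀ : ℝ}
    (hM : IsLinearModel P X Y Z δ₀ β σ)
    (hσ : 0 < σ) (A : ResidualBasis d) (hX : ∀ i, Measurable (X i)) (hY : ∀ i, Measurable (Y i))
    (hZ : ∀ i, Measurable (Z i)) (δp : ℝ) {m n : ℕ} (h : m ≤ n)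
    {s : Set Ω} (hs : MeasurableSet[obsFiltration A hX hY hZ m] s) :
    ∫⁻ ω in s, ENNReal.ofReal (likelihoodRatioProcess A δ₀ δp X Y Z n ω) ∂P =
      ∫⁻ ω in s, ENNReal.ofReal (likelihoodRatioProcess A δ₀ δp X Y Z m ω) ∂P := by
  obtain ⟨S, hS, h1, h2⟩ := hM.setLIntegral_likelihoodRatioProcess A hX hY hZ δ₀ δp h hs
  rw [h1, h2]
  exact lintegral_congr fun c => setLIntegral_likelihoodRatio_eq A h δ₀ δp β hσ c.1 c.2 (hS c)

theorem IsLinearModel.integrable_likelihoodRatioProcess (hM : IsLinearModel P X Y Z δ β σ)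
    (hσ : 0 < σ) (A : ResidualBasis d) (hX : ∀ i, Measurable (X i)) (hY : ∀ i, Measurable (Y i))
    (hZ : ∀ i, Measurable (Z i)) {δ₀ δp : ℝ} (hδ : δ ≤ δ₀) (hδp : δ₀ ≤ δp) (n : ℕ) :
    Integrable (likelihoodRatioProcess A δ₀ δp X Y Z n) P := by
  have hm := ((stronglyAdapted_likelihoodRatioProcess A hX hY hZ δ₀ δp n).mono
    ((obsFiltration A hX hY hZ).le n)).aestronglyMeasurable (μ := P)
  refine ⟨hm, ?_⟩
  rw [hasFiniteIntegral_iff_ofReal (Filter.Eventually.of_forall fun ω =>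
    likelihoodRatioProcess_nonneg A δ₀ δp n ω)]
  have h := hM.setLIntegral_likelihoodRatioProcess_le hσ A hX hY hZ hδ hδp (Nat.zero_le n)
    MeasurableSet.univ
  simp only [Measure.restrict_univ, likelihoodRatioProcess_zero] at h
  refine h.trans_lt ?_
  simp

theorem IsLinearModel.supermartingale_likelihoodRatioProcess (hM : IsLinearModel P X Y Z δ β σ)
    (hσ : 0 < σ) (A : ResidualBasis d) (hX : ∀ i, Measurable (X i)) (hY : ∀ i, Measurable (Y i))
    (hZ : ∀ i, Measurable (Z i)) {δ₀ δp : ℝ} (hδ : δ ≤ δ₀) (hδp : δ₀ ≤ δp) :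
    Supermartingale (likelihoodRatioProcess A δ₀ δp X Y Z) (obsFiltration A hX hY hZ) P := by
  have hint := hM.integrable_likelihoodRatioProcess hσ A hX hY hZ hδ hδp
  refine supermartingale_of_setIntegral_succ_le
    (stronglyAdapted_likelihoodRatioProcess A hX hY hZ δ₀ δp) hint fun n s hs => ?_
  have h0 : ∀ k, 0 ≤ᵐ[P.restrict s] likelihoodRatioProcess A δ₀ δp X Y Z k := fun k =>
    Filter.Eventually.of_forall fun ω => likelihoodRatioProcess_nonneg A δ₀ δp k ω
  rw [integral_eq_lintegral_of_nonneg_ae (h0 _) (hint _).integrableOn.1,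
    integral_eq_lintegral_of_nonneg_ae (h0 _) (hint _).integrableOn.1]
  exact ENNReal.toReal_mono ((hint n).integrableOn.lintegral_lt_top).ne
    (hM.setLIntegral_likelihoodRatioProcess_le hσ A hX hY hZ hδ hδp n.le_succ hs)

theorem IsLinearModel.martingale_likelihoodRatioProcess {δ₀ δp : ℝ}
    (hM : IsLinearModel P X Y Z δ₀ β σ) (hσ : 0 < σ) (A : ResidualBasis d)
    (hX : ∀ i, Measurable (X i)) (hY : ∀ i, Measurable (Y i)) (hZ : ∀ i, Measurable (Z i))
    (hδp : δ₀ ≤ δp) :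
    Martingale (likelihoodRatioProcess A δ₀ δp X Y Z) (obsFiltration A hX hY hZ) P := by
  have hint := hM.integrable_likelihoodRatioProcess hσ A hX hY hZ le_rfl hδp
  refine martingale_of_setIntegral_eq_succ
    (stronglyAdapted_likelihoodRatioProcess A hX hY hZ δ₀ δp) hint fun n s hs => ?_
  have h0 : ∀ k, 0 ≤ᵐ[P.restrict s] likelihoodRatioProcess A δ₀ δp X Y Z k := fun k =>
    Filter.Eventually.of_forall fun ω => likelihoodRatioProcess_nonneg A δ₀ δp k ω
  rw [integral_eq_lintegral_of_nonneg_ae (h0 _) (hint _).integrableOn.1,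
    integral_eq_lintegral_of_nonneg_ae (h0 _) (hint _).integrableOn.1,
    hM.setLIntegral_likelihoodRatioProcess_eq hσ A hX hY hZ δp n.le_succ hs]

end Sequential

end

theorem mainTheorem4 {d : ℕ} (A : ResidualBasis d) {Ω : Type*} [MeasurableSpace Ω]
    (P : Measure Ω) [IsProbabilityMeasure P]
    (X Y : ℕ → Ω → ℝ) (Z : ℕ → Ω → Fin d → ℝ)
    (hX : ∀ i, Measurable (X i)) (hY : ∀ i, Measurable (Y i)) (hZ : ∀ i, Measurable (Z i))
    (δ₀ δp : ℝ) (hδ : δ₀ < δp) :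
    -- `noncentralTPDF` is the density of the noncentral `t` distribution
    (∀ (ν : ℕ) (lam : ℝ), 1 ≤ ν → noncentralT ν lam =
      volume.withDensity fun t => ENNReal.ofReal (noncentralTPDF ν lam t)) ∧
    -- monotone likelihood ratio property of the noncentral `t` family
    (∀ (ν : ℕ) (lam₀ lamp : ℝ), 1 ≤ ν → lam₀ ≤ lamp →
      Monotone fun t => noncentralTPDF ν lamp t / noncentralTPDF ν lam₀ t) ∧
    -- results for fixed covariates `x, z`
    (∀ (n : ℕ) (x : Fin n → ℝ) (z : Fin n → Fin d → ℝ),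
      -- the law of `Uₙ` depends on the parameters through `δ` only
      (∀ (δ : ℝ) (β : Fin d → ℝ) (σ : ℝ), 0 < σ →
        residualLaw A δ β σ x z = residualLaw A δ 0 1 x z) ∧
      -- sufficiency of `Tₙ`: factorization of the density of `Uₙ` on the sphere
      (2 ≤ resDim z → ∀ (δ : ℝ) (β : Fin d → ℝ) (σ : ℝ), 0 < σ →
        residualLaw A δ β σ x z = (sphereMeasure (resDim z)).withDensity fun u =>
          ENNReal.ofReal
            (qFactor (resDim z - 1) (tStat (compress (A.mat n z) x) u) *
              noncentralTPDF (resDim z - 1) (δ * ‖compress (A.mat n z) x‖)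
                (tStat (compress (A.mat n z) x) u))) ∧
      -- `Tₙ` has a noncentral `t` distribution
      (2 ≤ resDim z → compress (A.mat n z) x ≠ 0 → ∀ (δ : ℝ) (β : Fin d → ℝ) (σ : ℝ), 0 < σ →
        (residualLaw A δ β σ x z).map (tStat (compress (A.mat n z) x)) =
          noncentralT (resDim z - 1) (δ * ‖compress (A.mat n z) x‖)) ∧
      -- `likelihoodRatio` is the density of `Uₙ` under `δp` relative to that under `δ₀`
      (∀ (βp β₀ : Fin d → ℝ) (σp σ₀ : ℝ), 0 < σp → 0 < σ₀ →
        residualLaw A δp βp σp x z = (residualLaw A δ₀ β₀ σ₀ x z).withDensity fun u =>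
          ENNReal.ofReal (likelihoodRatio A δ₀ δp x z u))) ∧
    -- the conditional law of `Uₙ` given the covariates
    (∀ (δ : ℝ) (β : Fin d → ℝ) (σ : ℝ), 0 < σ → IsLinearModel P X Y Z δ β σ →
      ∀ (n : ℕ) (B : Set (Σ k : ℕ, EuclideanSpace ℝ (Fin k))), MeasurableSet B →
        P⟦residualSigma A Y Z n ⁻¹' B | MeasurableSpace.comap (covariates X Z n) inferInstance⟧
          =ᵐ[P] fun ω => (residualLaw A δ β σ (firstN X n ω) (firstN Z n ω)).real
            {u | (⟨resDim (firstN Z n ω), u⟩ : Σ k : ℕ, EuclideanSpace ℝ (Fin k)) ∈ B}) ∧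
    -- the likelihood ratio process is a test supermartingale for `δ ≤ δ₀` ...
    (∀ n ω, 0 ≤ likelihoodRatioProcess A δ₀ δp X Y Z n ω) ∧
    (∀ ω, likelihoodRatioProcess A δ₀ δp X Y Z 0 ω = 1) ∧
    (∀ (δ : ℝ) (β : Fin d → ℝ) (σ : ℝ), 0 < σ → δ ≤ δ₀ → IsLinearModel P X Y Z δ β σ →
      Supermartingale (likelihoodRatioProcess A δ₀ δp X Y Z) (obsFiltration A hX hY hZ) P) ∧
    -- ... and a martingale for `δ = δ₀`
    (∀ (β : Fin d → ℝ) (σ : ℝ), 0 < σ → IsLinearModel P X Y Z δ₀ β σ →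
      Martingale (likelihoodRatioProcess A δ₀ δp X Y Z) (obsFiltration A hX hY hZ) P) := by
  refine ⟨fun ν lam hν => noncentralT_eq_withDensity hν lam,
    fun ν lam₀ lamp hν h => monotone_noncentralTPDF_div hν h, fun n x z => ⟨?_, ?_, ?_, ?_⟩,
    fun δ β σ _ hM n B hB => hM.condExp_residualSigma A hX hY hZ n hB,
    fun n ω => likelihoodRatioProcess_nonneg A δ₀ δp n ω,
    fun ω => likelihoodRatioProcess_zero A δ₀ δp ω,
    fun δ β σ hσ hδ' hM => hM.supermartingale_likelihoodRatioProcess hσ A hX hY hZ hδ' hδ.le,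
    fun β σ hσ hM => hM.martingale_likelihoodRatioProcess hσ A hX hY hZ hδ.le⟩
  · intro δ β σ hσ
    rw [residualLaw_eq_map A δ β hσ, residualLaw_eq_map A δ 0 one_pos]
  · exact fun hk δ β σ hσ => residualLaw_eq_withDensity_tStat A δ β hσ x z hk
  · exact fun hk hb δ β σ hσ => map_tStat_residualLaw A δ β hσ x z hk hb
  · exact fun βp β₀ σp σ₀ hp h0 =>
      residualLaw_eq_withDensity_likelihoodRatio A δ₀ δp β₀ βp h0 hp x z
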